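/- Let $\mathbb{K}$ be $\mathbb{R}$ or $\mathbb{C}$, let $V$ and $V^{\uparrow}$ be finite-dimensional normed $\mathbb{K}$-vector spaces, let $\rho$ be a continuous representation of $SO(2)$ on $V$ and $\rho^{\uparrow}$ a continuous representation of $SO(3)$ on $V^{\uparrow}$. Regard $SO(2)\subset SO(3)$ as the group of in-plane rotations (rotations of $\mathbb{R}^3$ about the third axis). Let $\mathcal{F}$ be the space of bounded measurable compactly supported fields $f:\mathbb{R}^2\to V$, on which $SO(2)$ acts by $(\pi(h)f)(r)=\rho(h)f(h^{-1}r)$; on fields $S^2\to V^{\uparrow}$, identified when they agree almost everywhere, $SO(3)$ acts by $(\pi^{\uparrow}(g)f^{\uparrow})(\hat n)=\rho^{\uparrow}(g)f^{\uparrow}(g^{-1}\hat n)$. Let $\kappa:S^2\times\mathbb{R}^2\to\mathrm{Hom}(V,V^{\uparrow})$ be jointly measurable, with $\kappa(\hat n,\cdot)$ locally integrable for almost every $\hat n$ and $\kappa(\cdot,r)$ square integrable on $S^2$ for almost every $r$, and let $\Phi$ be the linear map on $\mathcal{F}$ with $$[\Phi(f)](\hat n)=\int_{\mathbb{R}^2}\kappa(\hat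 n,r)f(r)\,dr\qquad\text{for almost every }\hat n\in S^2 .$$ For each $\ell\ge 0$ let $(Y_\ell^k)_k$ be any basis (for instance the standard orthonormal one, $-\ell\le k\le\ell$) of the space of spherical harmonics of degree $\ell$ on $S^2$, let $Y_\ell(\hat n)=(Y_\ell^k(\hat n))_k\in W^\ell$ be the vector of their values, where $W^\ell$ is the space of coordinate vectors indexed by $k$, and let $D^\ell$ be the representation of $SO(3)$ on $W^\ell$ determined by $Y_\ell(g\hat n)=D^\ell(g)Y_\ell(\hat n)$. Then $\Phi$ is $SO(2)$-equivariant, that is, $\Phi(\pi(h)f)=\pi^{\uparrow}(h)\Phi(f)$ almost everywhere on $S^2$ for all $h\in SO(2)$ and $f\in\mathcal{F}$, if and only if there are functions $F_\ell:\mathbb{R}^2\to\mathrm{Hom}(V\otimes W^\ell,V^{\uparrow})$, $\ell\ge 0$, such that for almost every $r\in\mathbb{R}^2$ $$\kappa(\hat n,r)=\sum_{\ell=0}^{\infty}F_\ell(r)^TY_\ell(\hat n)\quad\text{with convergence in }L^2(S^2),\qquad F_\ell(r)^TY_\ell(\hat n):=\bigl(v\mapsto F_\ell(r)(v\otimes Y_\ell(\hat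 n))\bigr),$$ and each $F_\ell$ is an $SO(2)$-steerable kernel with input representation $\rho^\ell=\rho\otimes\mathrm{Res}^{SO(3)}_{SO(2)}D^\ell$ and output representation $\mathrm{Res}^{SO(3)}_{SO(2)}\rho^{\uparrow}$, that is, $F_\ell(hr)=\rho^{\uparrow}(h)F_\ell(r)\rho^\ell(h^{-1})$ for all $h\in SO(2)$ and $r\in\mathbb{R}^2$. -/

import Mathlib

open MeasureTheory Filter Topology
open scoped TensorProduct ENNReal

noncomputable section

/-- The rotation group `SO(n)`. -/
abbrev SO (n : ℕ) : Type := Matrix.specialOrthogonalGroup (Fin n) ℝ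

/-- Euclidean space `ℝⁿ`. -/
abbrev E (n : ℕ) : Type := EuclideanSpace ℝ (Fin n)

/-- The unit sphere `S²` in `ℝ³`. -/
abbrev S2 : Type := Metric.sphere (0 : E 3) 1

/-- The rotation invariant surface measure of `S²` (total mass `4π`). -/
abbrev sphereMeasure : Measure S2 := (volume : Measure (E 3)).toSphere

theorem SO.mul_transpose {n : ℕ} (g : SO n) : g.1 * g.1.transpose = 1 := by
  have h := (Matrix.mem_specialOrthogonalGroup_iff.1 g.2).1
  have := (Matrix.mem_orthogonalGroup_iff (Fin n) ℝ).1 h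
  simpa [Matrix.star_eq_conjTranspose] using this

theorem SO.transpose_mul {n : ℕ} (g : SO n) : g.1.transpose * g.1 = 1 :=
  mul_eq_one_comm.1 (SO.mul_transpose g)

theorem SO.norm_mulVec {n : ℕ} (g : SO n) (x : E n) :
    ‖(WithLp.toLp 2 (g.1.mulVec x.ofLp) : E n)‖ = ‖x‖ := by
  have h : ∀ y : E n, ‖y‖ ^ 2 = y.ofLp ⬝ᵥ y.ofLp := by
    intro y
    rw [EuclideanSpace.real_norm_sq_eq]
    simp [dotProduct, sq]
  have h2 : ‖(WithLp.toLp 2 (g.1.mulVec x.ofLp) : E n)‖ ^ 2 = ‖x‖ ^ 2 := by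
    rw [h, h]
    simp only
    rw [Matrix.dotProduct_mulVec, Matrix.vecMul_mulVec, SO.transpose_mul]
    simp
  exact (sq_eq_sq₀ (norm_nonneg _) (norm_nonneg _)).1 h2

/-- The action `x ↦ g x` of a rotation on `ℝⁿ`, by matrix-vector multiplication. -/
def rot {n : ℕ} (g : SO n) : E n ≃ₗᵢ[ℝ] E n where
  toFun x := WithLp.toLp 2 (g.1.mulVec x.ofLp)
  invFun x := WithLp.toLp 2 ((g⁻¹).1.mulVec x.ofLp)
  map_add' x y := by simp [Matrix.mulVec_add]
  map_smul' c x := by simp [Matrix.mulVec_smul]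
  left_inv x := by
    have h : (g⁻¹).1 * g.1 = 1 := congrArg Subtype.val (inv_mul_cancel g)
    simp [h]
  right_inv x := by
    have h : g.1 * (g⁻¹).1 = 1 := congrArg Subtype.val (mul_inv_cancel g)
    simp [h]
  norm_map' x := SO.norm_mulVec g x

theorem rot_apply {n : ℕ} (g : SO n) (x : E n) (i : Fin n) :
    rot g x i = ∑ j, g.1 i j * x j := rfl

theorem rot_one {n : ℕ} (x : E n) : rot (1 : SO n) x = x := by
  ext i
  simp [rot_apply, Matrix.one_apply]

theorem rot_mul {n : ℕ} (g h : SO n) (x : E n) : rot (g * h) x = rot g (rot h x) := by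
  change WithLp.toLp 2 ((g.1 * h.1).mulVec x.ofLp) = WithLp.toLp 2 (g.1.mulVec (h.1.mulVec x.ofLp))
  rw [Matrix.mulVec_mulVec]

/-- The action of `SO(3)` on `S²`. -/
def rotS (g : SO 3) (n : S2) : S2 :=
  ⟨rot g n.1, by
    have := n.2
    rw [mem_sphere_zero_iff_norm] at this ⊢
    rw [LinearIsometryEquiv.norm_map, this]⟩

theorem rotS_one (n : S2) : rotS 1 n = n := Subtype.ext (rot_one _)

theorem rotS_mul (g h : SO 3) (n : S2) : rotS (g * h) n = rotS g (rotS h n) :=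
  Subtype.ext (rot_mul _ _ _)

/-- The matrix of an in-plane rotation, regarded as a rotation about the third axis. -/
def inPlaneMatrix (A : Matrix (Fin 2) (Fin 2) ℝ) : Matrix (Fin 3) (Fin 3) ℝ :=
  !![A 0 0, A 0 1, 0; A 1 0, A 1 1, 0; 0, 0, 1]

theorem inPlaneMatrix_mul (A B : Matrix (Fin 2) (Fin 2) ℝ) :
    inPlaneMatrix (A * B) = inPlaneMatrix A * inPlaneMatrix B := by
  ext i j
  fin_cases i <;> fin_cases j <;>
    simp [inPlaneMatrix, Matrix.mul_apply, Fin.sum_univ_succ]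

theorem inPlaneMatrix_one : inPlaneMatrix 1 = 1 := by
  ext i j
  fin_cases i <;> fin_cases j <;> simp [inPlaneMatrix]

theorem inPlaneMatrix_transpose (A : Matrix (Fin 2) (Fin 2) ℝ) :
    inPlaneMatrix A.transpose = (inPlaneMatrix A).transpose := by
  ext i j
  fin_cases i <;> fin_cases j <;> simp [inPlaneMatrix]

/-- The inclusion `SO(2) ⊂ SO(3)` as the group of in-plane rotations. -/
def inPlane : SO 2 →* SO 3 where
  toFun h := ⟨inPlaneMatrix h.1, by
    rw [Matrix.mem_specialOrthogonalGroup_iff, Matrix.mem_orthogonalGroup_iff]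
    constructor
    · have := SO.mul_transpose h
      rw [← inPlaneMatrix_transpose, ← inPlaneMatrix_mul, this, inPlaneMatrix_one]
    · have := (Matrix.mem_specialOrthogonalGroup_iff.1 h.2).2
      rw [Matrix.det_fin_two] at this
      simp [inPlaneMatrix, Matrix.det_fin_three, this]⟩
  map_one' := Subtype.ext inPlaneMatrix_one
  map_mul' g h := Subtype.ext (inPlaneMatrix_mul g.1 h.1)

/-! ### Spherical harmonics -/

section Harmonics

variable (𝕜 : Type*) [RCLike 𝕜]

/-- The Laplacian `∂₁² + ∂₂² + ∂₃²` on polynomials in three variables. -/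
def polyLaplacian : MvPolynomial (Fin 3) 𝕜 →ₗ[𝕜] MvPolynomial (Fin 3) 𝕜 :=
  ∑ i : Fin 3, (MvPolynomial.pderiv i).toLinearMap ∘ₗ (MvPolynomial.pderiv i).toLinearMap

/-- Restriction of a polynomial function on `ℝ³` to `S²`. -/
def restrictToSphere : MvPolynomial (Fin 3) 𝕜 →ₗ[𝕜] (S2 → 𝕜) where
  toFun p n := MvPolynomial.eval (fun i => ((n.1 i : ℝ) : 𝕜)) p
  map_add' p q := by ext n; simp
  map_smul' c p := by ext n; simp [MvPolynomial.smul_eval]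

/-- The space of spherical harmonics of degree `ℓ`: the restrictions to `S²` of the homogeneous
harmonic polynomials of degree `ℓ` on `ℝ³`. -/
def sphericalHarmonics (ℓ : ℕ) : Submodule 𝕜 (S2 → 𝕜) :=
  (MvPolynomial.homogeneousSubmodule (Fin 3) 𝕜 ℓ ⊓ LinearMap.ker (polyLaplacian 𝕜)).map
    (restrictToSphere 𝕜)

variable {𝕜}

/-- The linear change of variables `p ↦ p ∘ g` on polynomials. -/
def polyRot (g : SO 3) : MvPolynomial (Fin 3) 𝕜 →ₐ[𝕜] MvPolynomial (Fin 3) 𝕜 :=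
  MvPolynomial.aeval fun j => ∑ k, MvPolynomial.C ((g.1 j k : ℝ) : 𝕜) * MvPolynomial.X k

theorem restrictToSphere_polyRot (g : SO 3) (p : MvPolynomial (Fin 3) 𝕜) (n : S2) :
    restrictToSphere 𝕜 (polyRot g p) n = restrictToSphere 𝕜 p (rotS g n) := by
  induction p using MvPolynomial.induction_on with
  | C a => simp [restrictToSphere, polyRot]
  | add p q hp hq => simp only [map_add, Pi.add_apply, hp, hq]
  | mul_X p i hp =>
    have hp' : MvPolynomial.eval (fun i => ((n.1 i : ℝ) : 𝕜)) (polyRot g p)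
        = MvPolynomial.eval (fun i => (((rotS g n).1 i : ℝ) : 𝕜)) p := hp
    simp only [restrictToSphere, LinearMap.coe_mk, AddHom.coe_mk, map_mul, hp']
    congr 1
    simp [polyRot, rotS, rot_apply]

theorem polyRot_isHomogeneous (g : SO 3) {ℓ : ℕ} {p : MvPolynomial (Fin 3) 𝕜}
    (hp : p.IsHomogeneous ℓ) : (polyRot g p).IsHomogeneous ℓ := by
  have := hp.aeval (fun j => ∑ k, MvPolynomial.C ((g.1 j k : ℝ) : 𝕜) * MvPolynomial.X k)
    (n := 1) (fun j => MvPolynomial.IsHomogeneous.sum _ _ _ fun k _ =>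
      MvPolynomial.IsHomogeneous.C_mul (MvPolynomial.isHomogeneous_X 𝕜 k) _)
  simpa [polyRot] using this

theorem pderiv_polyRot (g : SO 3) (p : MvPolynomial (Fin 3) 𝕜) (i : Fin 3) :
    MvPolynomial.pderiv i (polyRot g p)
      = ∑ j, MvPolynomial.C ((g.1 j i : ℝ) : 𝕜) * polyRot g (MvPolynomial.pderiv j p) := by
  classical
  induction p using MvPolynomial.induction_on with
  | C a => simp [polyRot]
  | add p q hp hq => simp only [map_add, hp, hq, mul_add, Finset.sum_add_distrib]
  | mul_X p m hp =>
    have hX : MvPolynomial.pderiv i (polyRot g (MvPolynomial.X m : MvPolynomial (Fin 3) 𝕜))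
        = MvPolynomial.C ((g.1 m i : ℝ) : 𝕜) := by
      simp [polyRot, MvPolynomial.pderiv_X, Pi.single_apply]
    rw [map_mul, MvPolynomial.pderiv_mul, hp, hX]
    simp only [MvPolynomial.pderiv_mul, MvPolynomial.pderiv_X, map_add, map_mul, mul_add,
      Finset.sum_add_distrib, Finset.sum_mul]
    congr 1
    · exact Finset.sum_congr rfl fun j _ => by ring
    · rw [Finset.sum_eq_single m]
      · simp [mul_comm]
      · intro j _ hj
        simp [hj.symm]
      · simp

theorem polyLaplacian_polyRot (g : SO 3) (p : MvPolynomial (Fin 3) 𝕜) :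
    polyLaplacian 𝕜 (polyRot g p) = polyRot g (polyLaplacian 𝕜 p) := by
  have key : ∀ j k : Fin 3, ∑ i, ((g.1 j i : ℝ) : 𝕜) * ((g.1 k i : ℝ) : 𝕜)
      = if j = k then 1 else 0 := by
    intro j k
    have := congrFun (congrFun (SO.mul_transpose g) j) k
    rw [Matrix.mul_apply, Matrix.one_apply] at this
    simp only [Matrix.transpose_apply] at this
    have h2 := congrArg (fun x : ℝ => (x : 𝕜)) this
    simp only [map_sum, map_mul] at h2
    rw [h2]
    split_ifs <;> simp
  simp only [polyLaplacian, LinearMap.sum_apply, LinearMap.comp_apply,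
    Derivation.coeFn_coe, pderiv_polyRot, map_sum,
    MvPolynomial.pderiv_C_mul, Finset.mul_sum]
  rw [Finset.sum_comm]
  refine Finset.sum_congr rfl fun j _ => ?_
  rw [Finset.sum_comm]
  have : ∀ k : Fin 3, ∑ i, MvPolynomial.C ((g.1 j i : ℝ) : 𝕜) *
      (MvPolynomial.C ((g.1 k i : ℝ) : 𝕜) *
        polyRot g (MvPolynomial.pderiv k (MvPolynomial.pderiv j p)))
      = if j = k then polyRot g (MvPolynomial.pderiv k (MvPolynomial.pderiv j p)) else 0 := by
    intro k
    have hC : ∑ i, MvPolynomial.C (σ := Fin 3) ((g.1 j i : ℝ) : 𝕜) *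
        MvPolynomial.C ((g.1 k i : ℝ) : 𝕜) = if j = k then 1 else 0 := by
      rw [← map_one (MvPolynomial.C (σ := Fin 3) (R := 𝕜)), ← map_zero (MvPolynomial.C (σ := Fin 3)),
        ← apply_ite (MvPolynomial.C (σ := Fin 3) (R := 𝕜)), ← key j k, map_sum]
      simp only [map_mul]
    simp only [← mul_assoc, ← Finset.sum_mul]
    rw [hC]
    split_ifs <;> simp
  simp only [this]
  simp

theorem comp_rotS_mem (g : SO 3) {ℓ : ℕ} {y : S2 → 𝕜} (hy : y ∈ sphericalHarmonics 𝕜 ℓ) :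
    (fun n => y (rotS g n)) ∈ sphericalHarmonics 𝕜 ℓ := by
  obtain ⟨p, ⟨hp1, hp2⟩, rfl⟩ := hy
  refine ⟨polyRot g p, ⟨polyRot_isHomogeneous g hp1, ?_⟩, ?_⟩
  · have : polyLaplacian 𝕜 p = 0 := hp2
    change polyLaplacian 𝕜 (polyRot g p) = 0
    rw [polyLaplacian_polyRot, this, map_zero]
  · ext n
    exact restrictToSphere_polyRot g p n

/-- Precomposition `y ↦ y ∘ g` on the spherical harmonics of degree `ℓ`. -/
def harmonicComp (ℓ : ℕ) (g : SO 3) : sphericalHarmonics 𝕜 ℓ →ₗ[𝕜] sphericalHarmonics 𝕜 ℓ where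
  toFun y := ⟨fun n => y.1 (rotS g n), comp_rotS_mem g y.2⟩
  map_add' _ _ := rfl
  map_smul' _ _ := rfl

theorem harmonicComp_one (ℓ : ℕ) : harmonicComp (𝕜 := 𝕜) ℓ 1 = LinearMap.id := by
  ext y n
  simp [harmonicComp, rotS_one]

theorem harmonicComp_mul (ℓ : ℕ) (g h : SO 3) :
    harmonicComp (𝕜 := 𝕜) ℓ (g * h) = harmonicComp ℓ h ∘ₗ harmonicComp ℓ g := by
  ext y n
  simp [harmonicComp, rotS_mul]

variable {ι : Type*} [Fintype ι]

/-- The vector `Y_ℓ(n) = (Y_ℓ^k(n))_k` of the members of a basis of the spherical harmonics of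
degree `ℓ`, evaluated at `n`. -/
def harmonicVector {ℓ : ℕ} (Y : Module.Basis ι 𝕜 (sphericalHarmonics 𝕜 ℓ)) (n : S2) : ι → 𝕜 :=
  fun k => (Y k).1 n

/-- The Wigner representation `D^ℓ` of `SO(3)` on `W^ℓ = 𝕜^ι`, where `ι` indexes a basis `Y_ℓ^k` of
the spherical harmonics of degree `ℓ`: the matrix `D^ℓ(g)` is the one with
`Y_ℓ^k(g n) = ∑ k', D^ℓ(g)_{k k'} Y_ℓ^{k'}(n)`. -/
def wignerD [DecidableEq ι] {ℓ : ℕ} (Y : Module.Basis ι 𝕜 (sphericalHarmonics 𝕜 ℓ)) :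
    Representation 𝕜 (SO 3) (ι → 𝕜) where
  toFun g := Matrix.toLin' (LinearMap.toMatrix Y Y (harmonicComp ℓ g)).transpose
  map_one' := by
    rw [harmonicComp_one, LinearMap.toMatrix_id]
    simp
    rfl
  map_mul' g h := by
    rw [harmonicComp_mul, LinearMap.toMatrix_comp Y Y Y, Matrix.transpose_mul, Matrix.toLin'_mul]
    rfl

theorem harmonicVector_rotS [DecidableEq ι] {ℓ : ℕ}
    (Y : Module.Basis ι 𝕜 (sphericalHarmonics 𝕜 ℓ)) (g : SO 3) (n : S2) :
    harmonicVector Y (rotS g n) = wignerD Y g (harmonicVector Y n) := by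
  ext k
  change (Y k).1 (rotS g n) =
    ((LinearMap.toMatrix Y Y (harmonicComp ℓ g)).transpose.mulVec (harmonicVector Y n)) k
  have h : ∑ i, Y.repr (harmonicComp ℓ g (Y k)) i • Y i = harmonicComp ℓ g (Y k) :=
    Y.sum_repr _
  have h2 := congrFun (congrArg Subtype.val h) n
  simp only [Submodule.coe_sum, Finset.sum_apply, Submodule.coe_smul, Pi.smul_apply,
    smul_eq_mul] at h2
  simp only [Matrix.mulVec, dotProduct, Matrix.transpose_apply, LinearMap.toMatrix_apply,
    harmonicVector]
  exact h2.symm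

end Harmonics

/-! ### Feature fields and steerable kernels -/

section Fields

variable (𝕜 : Type*) [RCLike 𝕜] (V : Type*) [NormedAddCommGroup V] [NormedSpace 𝕜 V]

/-- Planar feature fields `f : ℝ² → V`: the bounded measurable functions with compact support. -/
def planarFields : Submodule 𝕜 (E 2 → V) where
  carrier := {f | MemLp f ∞ volume ∧ HasCompactSupport f}
  zero_mem' := ⟨MemLp.zero, HasCompactSupport.zero⟩
  add_mem' hf hg := ⟨hf.1.add hg.1, hf.2.add hg.2⟩
  smul_mem' c _ hf := ⟨hf.1.const_smul c, hf.2.smul_left (f := fun _ => c)⟩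

variable {𝕜 V}

theorem planarFields_rot [FiniteDimensional 𝕜 V] (A : V →ₗ[𝕜] V) (h : SO 2) {f : E 2 → V}
    (hf : f ∈ planarFields 𝕜 V) : (fun r => A (f (rot h r))) ∈ planarFields 𝕜 V := by
  have h1 : MemLp (fun r => f (rot h r)) ∞ volume :=
    hf.1.comp_measurePreserving (rot h).measurePreserving
  have h2 : HasCompactSupport (fun r => f (rot h r)) :=
    hf.2.comp_homeomorph (rot h).toHomeomorph
  exact ⟨(LinearMap.toContinuousLinearMap A).comp_memLp' h1, h2.comp_left (map_zero A)⟩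

/-- The action `(π(h) f)(r) = ρ(h) f(h⁻¹ r)` of `SO(2)` on planar feature fields. -/
def planarRep [FiniteDimensional 𝕜 V] (ρ : Representation 𝕜 (SO 2) V) :
    Representation 𝕜 (SO 2) (planarFields 𝕜 V) where
  toFun h :=
    { toFun := fun f => ⟨fun r => ρ h (f.1 (rot h⁻¹ r)), planarFields_rot (ρ h) h⁻¹ f.2⟩
      map_add' := fun f g => by ext r; simp
      map_smul' := fun c f => by ext r; simp }
  map_one' := by
    ext f r
    simp [rot_one]
  map_mul' g h := by
    ext f r
    simp [rot_mul]

/-- The action `(π↑(g) f)(n) = ρ↑(g) f(g⁻¹ n)` of `SO(3)` on spherical feature fields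
`f : S² → U`. -/
def sphereRep {U : Type*} [AddCommGroup U] [Module 𝕜 U] (ρ : Representation 𝕜 (SO 3) U) :
    Representation 𝕜 (SO 3) (S2 → U) where
  toFun g :=
    { toFun := fun f n => ρ g (f (rotS g⁻¹ n))
      map_add' := fun f g => by ext r; simp
      map_smul' := fun c f => by ext r; simp }
  map_one' := by
    ext f n
    simp [rotS_one]
  map_mul' g h := by
    ext f n
    simp [rotS_mul]

/-- `SO(2)`-steerable kernels `F : ℝ² → Hom(W, U)` with input representation `σ` on `W` and output
representation `τ` on `U`: those with `F(h r) = τ(h) F(r) σ(h⁻¹)`. -/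
def IsSteerableKernel {W U : Type*} [AddCommGroup W] [Module 𝕜 W] [AddCommGroup U] [Module 𝕜 U]
    (σ : Representation 𝕜 (SO 2) W) (τ : Representation 𝕜 (SO 2) U)
    (F : E 2 → W →ₗ[𝕜] U) : Prop :=
  ∀ (h : SO 2) (r : E 2), F (rot h r) = τ h ∘ₗ F r ∘ₗ σ h⁻¹

/-- The contraction `F^T Y ∈ Hom(V, U)` of `F ∈ Hom(V ⊗ W, U)` with a vector `Y ∈ W`, that is
`v ↦ F (v ⊗ Y)`; for `W = 𝕜^ι` it is `∑ k, Y k • F^k`, where `F^k v = F (v ⊗ e_k)`. -/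
def contract [FiniteDimensional 𝕜 V] {U W : Type*} [NormedAddCommGroup U] [NormedSpace 𝕜 U]
    [AddCommGroup W] [Module 𝕜 W] (F : V ⊗[𝕜] W →ₗ[𝕜] U) (y : W) : V →L[𝕜] U :=
  LinearMap.toContinuousLinearMap (F ∘ₗ (TensorProduct.mk 𝕜 V W).flip y)

/-- The kernels `κ(n, r) ∈ Hom(V, U)` of image-to-sphere operators: `κ` is jointly measurable,
locally integrable in the point `r` of the plane for almost every `n`, and square integrable in the
point `n` of the sphere for almost every `r`. -/
structure IsImageToSphereKernel {U : Type*} [NormedAddCommGroup U] [NormedSpace 𝕜 U]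
    (κ : S2 → E 2 → V →L[𝕜] U) : Prop where
  aestronglyMeasurable : AEStronglyMeasurable (Function.uncurry κ) (sphereMeasure.prod volume)
  locallyIntegrable : ∀ᵐ n ∂sphereMeasure, LocallyIntegrable (κ n) volume
  memLp : ∀ᵐ r ∂(volume : Measure (E 2)), MemLp (fun n => κ n r) 2 sphereMeasure

end Fields

end

/-! Equivariance of Φ is invariance of its kernel. Rotations preserve the measures of the plane and
of the sphere, so substituting hr for r and hn for n turns Φ(π(h)f) = π↑(h)Φ(f) into an equality of
two integral operators. Testing on indicators of bounded sets identifies their kernels: ρ↑(h)⁻¹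
κ(hn, hr) ρ(h) = κ(n, r) for almost every r and n (`equivariant_iff_twistedKernel`).

Now expand κ(·, r) in spherical harmonics. As Y_ℓ(hn) = D^ℓ(h) Y_ℓ(n), the twist replaces the
coefficient F_ℓ(r) by ρ↑(h)⁻¹ F_ℓ(hr) ρ^ℓ(h) (`HasHarmonicExpansion.conj`). Coefficients determine
the function almost everywhere and the function determines the coefficients
(`HasHarmonicExpansion.ae_eq`, `HasHarmonicExpansion.unique`), so invariance of the kernel is
steerability of the coefficients, for each h and almost every r.

Steerability is required for every r and h, whereas the exceptional null set depends on h. Averaging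
the coefficients over the compact group SO(2) yields exactly equivariant functions that agree with
them almost everywhere (`exists_equivariant_ae_eq`); since there are countably many ℓ, the expansion
survives at almost every r. This needs coefficients measurable in r, which holds because they are
integrals of κ against fixed continuous functions (`exists_measurable_coefficients`).

The expansion itself rests on two facts. Harmonics of different degrees are orthogonal, being
eigenfunctions of the sum of squares of the infinitesimal rotations with different eigenvalues
(`integral_mul_eq_zero_of_harmonic`). Their span is dense in L²(S²), by Stone-Weierstrass and the
decomposition of polynomials into products of powers of |x|² with harmonic polynomials
(`topologicalClosure_iSup_range_harmonicLp`). -/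

noncomputable section

/-! ### Harmonic polynomials and the Fischer decomposition -/

section HarmonicPolynomials

open MvPolynomial

variable {𝕜 : Type*} [RCLike 𝕜]

theorem pderiv_comm {σ R : Type*} [CommSemiring R] (i j : σ) (p : MvPolynomial σ R) :
    pderiv i (pderiv j p) = pderiv j (pderiv i p) := by
  classical
  induction p using MvPolynomial.induction_on with
  | C a => simp
  | add p q hp hq => simp only [map_add, hp, hq]
  | mul_X p m hp =>
    simp only [pderiv_mul, pderiv_X, map_add, hp, Pi.single_apply]
    split_ifs <;> simp <;> ring

theorem polyLaplacian_apply (p : MvPolynomial (Fin 3) 𝕜) :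
    polyLaplacian 𝕜 p = ∑ i, pderiv i (pderiv i p) := by
  simp [polyLaplacian]

/-- The polynomial `x₀² + x₁² + x₂²`. -/
def normSqPoly (𝕜 : Type*) [RCLike 𝕜] : MvPolynomial (Fin 3) 𝕜 := ∑ i, X i ^ 2

/-- The Euler operator `∑ xᵢ ∂ᵢ`. -/
def eulerOp (p : MvPolynomial (Fin 3) 𝕜) : MvPolynomial (Fin 3) 𝕜 := ∑ i, X i * pderiv i p

/-- The infinitesimal rotation `xᵢ ∂ᵢ₊₁ - xᵢ₊₁ ∂ᵢ`. -/
def angularDeriv (i : Fin 3) : Derivation 𝕜 (MvPolynomial (Fin 3) 𝕜) (MvPolynomial (Fin 3) 𝕜) :=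
  (X i : MvPolynomial (Fin 3) 𝕜) • pderiv (i + 1) -
    (X (i + 1) : MvPolynomial (Fin 3) 𝕜) • pderiv i

theorem angularDeriv_apply (i : Fin 3) (p : MvPolynomial (Fin 3) 𝕜) :
    angularDeriv i p = X i * pderiv (i + 1) p - X (i + 1) * pderiv i p := by
  simp [angularDeriv]

theorem normSqPoly_isHomogeneous : (normSqPoly 𝕜).IsHomogeneous 2 :=
  IsHomogeneous.sum _ _ _ fun i _ => by simpa using (isHomogeneous_X 𝕜 i).pow 2

theorem eulerOp_of_isHomogeneous {d : ℕ} {p : MvPolynomial (Fin 3) 𝕜} (hp : p.IsHomogeneous d) :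
    eulerOp p = d • p :=
  hp.sum_X_mul_pderiv

theorem polyLaplacian_isHomogeneous {d : ℕ} {p : MvPolynomial (Fin 3) 𝕜}
    (hp : p.IsHomogeneous (d + 2)) : (polyLaplacian 𝕜 p).IsHomogeneous d := by
  rw [polyLaplacian_apply]
  exact IsHomogeneous.sum _ _ _ fun i _ => (hp.pderiv (i := i)).pderiv

theorem polyLaplacian_eq_zero_of_lt_two {d : ℕ} (hd : d < 2) {p : MvPolynomial (Fin 3) 𝕜}
    (hp : p.IsHomogeneous d) : polyLaplacian 𝕜 p = 0 := by
  rw [polyLaplacian_apply]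
  refine Finset.sum_eq_zero fun i _ => ?_
  have h0 : (pderiv i p).IsHomogeneous 0 := by
    have := hp.pderiv (i := i)
    rwa [show d - 1 = 0 by omega] at this
  rw [← totalDegree_zero_iff_isHomogeneous, totalDegree_eq_zero_iff_eq_C] at h0
  rw [h0, pderiv_C]

theorem polyLaplacian_normSqPoly_mul (q : MvPolynomial (Fin 3) 𝕜) :
    polyLaplacian 𝕜 (normSqPoly 𝕜 * q)
      = 6 * q + 4 * eulerOp q + normSqPoly 𝕜 * polyLaplacian 𝕜 q := by
  simp only [polyLaplacian_apply, normSqPoly, eulerOp, Fin.sum_univ_three, pderiv_mul, map_add,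
    pow_two, pderiv_X, Pi.single_apply]
  simp
  ring

/-- The left side is the Casimir operator of the rotations, that is, the spherical Laplacian. On
harmonic polynomials of degree d it acts as the scalar -d(d+1), which separates the degrees. -/
theorem sum_angularDeriv_sq (p : MvPolynomial (Fin 3) 𝕜) :
    ∑ i, angularDeriv i (angularDeriv i p)
      = normSqPoly 𝕜 * polyLaplacian 𝕜 p - eulerOp (eulerOp p) - eulerOp p := by
  simp only [polyLaplacian_apply, normSqPoly, eulerOp, Fin.sum_univ_three, pderiv_mul, map_add,
    pderiv_X, Pi.single_apply, angularDeriv_apply, map_sub, Fin.isValue,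
    show (0 : Fin 3) + 1 = 1 from rfl, show (1 : Fin 3) + 1 = 2 from rfl,
    show (2 : Fin 3) + 1 = 0 from rfl, pderiv_comm 1 0 p, pderiv_comm 2 0 p, pderiv_comm 2 1 p]
  simp
  ring

theorem sum_angularDeriv_sq_of_harmonic {d : ℕ} {p : MvPolynomial (Fin 3) 𝕜}
    (hp : p.IsHomogeneous d) (hΔ : polyLaplacian 𝕜 p = 0) :
    ∑ i, angularDeriv i (angularDeriv i p) = -((d * (d + 1) : ℕ) • p) := by
  rw [sum_angularDeriv_sq, hΔ, eulerOp_of_isHomogeneous hp]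
  have h : eulerOp (d • p) = d • d • p := by
    have h1 : (d • p).IsHomogeneous d := by
      have := hp.C_mul (d : 𝕜)
      rwa [← smul_eq_C_mul, Nat.cast_smul_eq_nsmul] at this
    exact eulerOp_of_isHomogeneous h1
  rw [h]
  simp only [nsmul_eq_mul]
  push_cast
  ring

/-- Harmonic homogeneous polynomials of degree `m`. -/
def harmonicPoly (𝕜 : Type*) [RCLike 𝕜] (m : ℕ) : Submodule 𝕜 (MvPolynomial (Fin 3) 𝕜) :=
  homogeneousSubmodule (Fin 3) 𝕜 m ⊓ LinearMap.ker (polyLaplacian 𝕜)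

theorem mem_harmonicPoly {m : ℕ} {p : MvPolynomial (Fin 3) 𝕜} :
    p ∈ harmonicPoly 𝕜 m ↔ p.IsHomogeneous m ∧ polyLaplacian 𝕜 p = 0 := Iff.rfl

/-- By the product rule and Euler's identity the i-th factor |x|² contributes 6 + 4(2i + m); the
constant is the sum over i ≤ j. What matters is that it is nonzero. -/
theorem polyLaplacian_normSqPoly_pow_mul {m : ℕ} {h : MvPolynomial (Fin 3) 𝕜}
    (hh : h ∈ harmonicPoly 𝕜 m) (j : ℕ) :
    polyLaplacian 𝕜 (normSqPoly 𝕜 ^ (j + 1) * h)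
      = ((2 * j + 2) * (2 * m + 2 * j + 3) : ℕ) • (normSqPoly 𝕜 ^ j * h) := by
  have hE : ∀ j, eulerOp (normSqPoly 𝕜 ^ j * h) = (2 * j + m) • (normSqPoly 𝕜 ^ j * h) :=
    fun j => eulerOp_of_isHomogeneous ((normSqPoly_isHomogeneous.pow j).mul hh.1)
  induction j with
  | zero =>
    rw [pow_succ', mul_assoc, polyLaplacian_normSqPoly_mul, hE, pow_zero, one_mul, hh.2]
    simp only [nsmul_eq_mul]
    push_cast
    ring
  | succ j ih =>
    rw [pow_succ', mul_assoc, polyLaplacian_normSqPoly_mul, hE, ih]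
    simp only [nsmul_eq_mul]
    push_cast
    ring

/-- The span of the products `|x|²ʲ h` of total degree `d`, with `h` harmonic and homogeneous. -/
def fischerSpan (𝕜 : Type*) [RCLike 𝕜] (d : ℕ) : Submodule 𝕜 (MvPolynomial (Fin 3) 𝕜) :=
  Submodule.span 𝕜 {p | ∃ (j m : ℕ) (h : MvPolynomial (Fin 3) 𝕜),
    m + 2 * j = d ∧ h ∈ harmonicPoly 𝕜 m ∧ p = normSqPoly 𝕜 ^ j * h}

theorem fischerSpan_isHomogeneous {d : ℕ} {p : MvPolynomial (Fin 3) 𝕜}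
    (hp : p ∈ fischerSpan 𝕜 d) : p.IsHomogeneous d := by
  suffices fischerSpan 𝕜 d ≤ homogeneousSubmodule (Fin 3) 𝕜 d from this hp
  refine Submodule.span_le.2 ?_
  rintro _ ⟨j, m, h, rfl, hh, rfl⟩
  have := (normSqPoly_isHomogeneous (𝕜 := 𝕜).pow j).mul hh.1
  rwa [add_comm] at this

theorem exists_polyLaplacian_eq {d : ℕ} {s : MvPolynomial (Fin 3) 𝕜} (hs : s ∈ fischerSpan 𝕜 d) :
    ∃ q ∈ fischerSpan 𝕜 (d + 2), polyLaplacian 𝕜 q = s := by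
  suffices fischerSpan 𝕜 d ≤ (fischerSpan 𝕜 (d + 2)).map (polyLaplacian 𝕜) by
    obtain ⟨q, hq, h⟩ := this hs
    exact ⟨q, hq, h⟩
  refine Submodule.span_le.2 ?_
  rintro _ ⟨j, m, h, rfl, hh, rfl⟩
  have hc : (((2 * j + 2) * (2 * m + 2 * j + 3) : ℕ) : 𝕜) ≠ 0 := by
    rw [Nat.cast_ne_zero]
    positivity
  refine ⟨(((2 * j + 2) * (2 * m + 2 * j + 3) : ℕ) : 𝕜)⁻¹ • (normSqPoly 𝕜 ^ (j + 1) * h), ?_, ?_⟩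
  · exact Submodule.smul_mem _ _ (Submodule.subset_span ⟨j + 1, m, h, by ring, hh, rfl⟩)
  · rw [map_smul, polyLaplacian_normSqPoly_pow_mul hh, ← Nat.cast_smul_eq_nsmul 𝕜, smul_smul,
      inv_mul_cancel₀ hc, one_smul]

/-- By induction Δp lies in the span of degree d - 2, on which Δ can be inverted inside the span of
degree d. Subtracting such a preimage from p leaves a harmonic polynomial. -/
theorem mem_fischerSpan_of_isHomogeneous (d : ℕ) {p : MvPolynomial (Fin 3) 𝕜}
    (hp : p.IsHomogeneous d) : p ∈ fischerSpan 𝕜 d := by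
  induction d using Nat.strong_induction_on generalizing p with
  | _ d ih =>
    have key : ∀ q : MvPolynomial (Fin 3) 𝕜, q.IsHomogeneous d → polyLaplacian 𝕜 q = 0 →
        q ∈ fischerSpan 𝕜 d := fun q hq hΔ =>
      Submodule.subset_span ⟨0, d, q, by simp, ⟨hq, hΔ⟩, by simp⟩
    rcases lt_or_ge d 2 with hd | hd
    · exact key p hp (polyLaplacian_eq_zero_of_lt_two hd hp)
    · obtain ⟨e, rfl⟩ := Nat.exists_eq_add_of_le' hd
      obtain ⟨q, hq, hΔq⟩ := exists_polyLaplacian_eq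
        (ih e (by omega) (polyLaplacian_isHomogeneous hp))
      have := key (p - q) (hp.sub (fischerSpan_isHomogeneous hq)) (by rw [map_sub, hΔq, sub_self])
      simpa using add_mem this hq

theorem restrictToSphere_mul (p q : MvPolynomial (Fin 3) 𝕜) (n : S2) :
    restrictToSphere 𝕜 (p * q) n = restrictToSphere 𝕜 p n * restrictToSphere 𝕜 q n := by
  simp [restrictToSphere]

theorem restrictToSphere_normSqPoly (n : S2) : restrictToSphere 𝕜 (normSqPoly 𝕜) n = 1 := by
  have h : ∑ i, n.1 i ^ 2 = 1 := by
    rw [← EuclideanSpace.real_norm_sq_eq, norm_eq_of_mem_sphere, one_pow]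
  have h2 := congrArg (fun x : ℝ => (x : 𝕜)) h
  simpa [restrictToSphere, normSqPoly] using h2

theorem restrictToSphere_mem_iSup (p : MvPolynomial (Fin 3) 𝕜) :
    restrictToSphere 𝕜 p ∈ ⨆ ℓ, sphericalHarmonics 𝕜 ℓ := by
  rw [← sum_homogeneousComponent p, map_sum]
  refine Submodule.sum_mem _ fun d _ => ?_
  have hd := mem_fischerSpan_of_isHomogeneous d (homogeneousComponent_isHomogeneous d p)
  suffices fischerSpan 𝕜 d ≤ (⨆ ℓ, sphericalHarmonics 𝕜 ℓ).comap (restrictToSphere 𝕜) from this hd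
  refine Submodule.span_le.2 ?_
  rintro _ ⟨j, m, h, rfl, hh, rfl⟩
  have : restrictToSphere 𝕜 (normSqPoly 𝕜 ^ j * h) = restrictToSphere 𝕜 h := by
    ext n
    rw [restrictToSphere_mul]
    have : restrictToSphere 𝕜 (normSqPoly 𝕜 ^ j) n = restrictToSphere 𝕜 (normSqPoly 𝕜) n ^ j := by
      simp [restrictToSphere]
    rw [this, restrictToSphere_normSqPoly, one_pow, one_mul]
  change restrictToSphere 𝕜 _ ∈ (⨆ ℓ, sphericalHarmonics 𝕜 ℓ : Submodule 𝕜 (S2 → 𝕜))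
  rw [this]
  exact Submodule.mem_iSup_of_mem m ⟨h, hh, rfl⟩

end HarmonicPolynomials

/-! ### Rotations of the sphere and invariance of its measure -/

section SphereRotations

theorem continuous_rot {n : ℕ} : Continuous fun p : SO n × E n => rot p.1 p.2 := by
  refine (PiLp.continuous_toLp 2 _).comp (continuous_pi fun i => ?_)
  change Continuous fun p : SO n × E n => rot p.1 p.2 i
  simp only [rot_apply]
  refine continuous_finsetSum _ fun j _ => ?_
  have h1 : Continuous fun p : SO n × E n => p.1.1 :=
    continuous_subtype_val.comp continuous_fst
  have h2 : Continuous fun p : SO n × E n => p.2.ofLp :=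
    (PiLp.continuous_ofLp 2 _).comp continuous_snd
  exact (h1.matrix_elem i j).mul ((continuous_apply j).comp h2)

theorem continuous_rotS : Continuous fun p : SO 3 × S2 => rotS p.1 p.2 :=
  (continuous_rot.comp
    (continuous_fst.prodMk (continuous_subtype_val.comp continuous_snd))).subtype_mk _

theorem rotS_inv_rotS (g : SO 3) (n : S2) : rotS g⁻¹ (rotS g n) = n := by
  rw [← rotS_mul, inv_mul_cancel, rotS_one]

theorem rotS_rotS_inv (g : SO 3) (n : S2) : rotS g (rotS g⁻¹ n) = n := by
  rw [← rotS_mul, mul_inv_cancel, rotS_one]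

theorem rot_inv_rot {k : ℕ} (g : SO k) (x : E k) : rot g⁻¹ (rot g x) = x := by
  rw [← rot_mul, inv_mul_cancel, rot_one]

theorem rot_rot_inv {k : ℕ} (g : SO k) (x : E k) : rot g (rot g⁻¹ x) = x := by
  rw [← rot_mul, mul_inv_cancel, rot_one]

theorem continuous_rotS_right (g : SO 3) : Continuous (rotS g) :=
  continuous_rotS.comp (by fun_prop : Continuous fun n : S2 => (g, n))

/-- The action of a rotation on the sphere, as a homeomorphism. -/
def rotSHomeomorph (g : SO 3) : S2 ≃ₜ S2 where
  toFun := rotS g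
  invFun := rotS g⁻¹
  left_inv := rotS_inv_rotS g
  right_inv := rotS_rotS_inv g
  continuous_toFun := continuous_rotS_right g
  continuous_invFun := continuous_rotS_right g⁻¹

open scoped Pointwise in
-- The surface measure of a set is a fixed multiple of the volume of the cone over it. Rotations
-- carry cones to cones and preserve volume.
theorem measurePreserving_rotS (g : SO 3) :
    MeasurePreserving (rotS g) sphereMeasure sphereMeasure := by
  refine ⟨(continuous_rotS_right g).measurable, ?_⟩
  ext s hs
  rw [Measure.map_apply (continuous_rotS_right g).measurable hs,
    Measure.toSphere_apply' _ ((continuous_rotS_right g).measurable hs),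
    Measure.toSphere_apply' _ hs]
  congr 1
  have h : Set.Ioo (0 : ℝ) 1 • ((↑) '' (rotS g ⁻¹' s) : Set (E 3))
      = rot g ⁻¹' (Set.Ioo (0 : ℝ) 1 • ((↑) '' s : Set (E 3))) := by
    ext x
    simp only [Set.mem_smul, Set.mem_image, Set.mem_preimage]
    constructor
    · rintro ⟨t, ht, _, ⟨n, hn, rfl⟩, rfl⟩
      exact ⟨t, ht, _, ⟨_, hn, rfl⟩, by rw [map_smul]; rfl⟩
    · rintro ⟨t, ht, _, ⟨n, hn, rfl⟩, hx⟩
      refine ⟨t, ht, _, ⟨rotS g⁻¹ n, by rwa [rotS_rotS_inv], rfl⟩, ?_⟩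
      apply (rot g).injective
      rw [map_smul, ← hx]
      congr 1
      exact rot_rot_inv g n.1
  rw [h]
  exact (rot g).measurePreserving.measure_preimage_emb
    (rot g).toHomeomorph.measurableEmbedding _

theorem measurableEmbedding_rotS (g : SO 3) : MeasurableEmbedding (rotS g) :=
  (rotSHomeomorph g).measurableEmbedding

/-- The rotation by the angle `s` in the plane of the coordinates `i` and `i + 1`. -/
def coordRotation (i : Fin 3) (s : ℝ) : SO 3 :=
  ⟨Matrix.of fun a b =>
    if a = i then (if b = i then Real.cos s else if b = i + 1 then -Real.sin s else 0)
    else if a = i + 1 then (if b = i then Real.sin s else if b = i + 1 then Real.cos s else 0)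
    else if b = a then 1 else 0, by
    have h := Real.sin_sq_add_cos_sq s
    rw [Matrix.mem_specialOrthogonalGroup_iff, Matrix.mem_orthogonalGroup_iff]
    constructor
    · ext a b
      fin_cases i <;> fin_cases a <;> fin_cases b <;>
        simp [Matrix.mul_apply, Fin.sum_univ_three] <;> nlinarith
    · fin_cases i <;> simp [Matrix.det_fin_three] <;> nlinarith⟩

theorem coordRotation_periodic (i : Fin 3) : coordRotation i (2 * Real.pi) = coordRotation i 0 := by
  apply Subtype.ext
  simp [coordRotation]

end SphereRotations

/-! ### Orthogonality of harmonics of different degrees -/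

section Orthogonality

open MvPolynomial

variable {𝕜 : Type*} [RCLike 𝕜]

theorem continuous_eval_coe (p : MvPolynomial (Fin 3) 𝕜) :
    Continuous fun x : E 3 => eval (fun i => ((x i : ℝ) : 𝕜)) p := by
  refine (MvPolynomial.continuous_eval p).comp (continuous_pi fun i => ?_)
  exact RCLike.continuous_ofReal.comp (by fun_prop)

theorem continuous_restrictToSphere (p : MvPolynomial (Fin 3) 𝕜) :
    Continuous (restrictToSphere 𝕜 p) :=
  (continuous_eval_coe p).comp continuous_subtype_val

theorem continuous_of_mem_sphericalHarmonics {ℓ : ℕ} {y : S2 → 𝕜}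
    (hy : y ∈ sphericalHarmonics 𝕜 ℓ) : Continuous y := by
  obtain ⟨p, -, rfl⟩ := hy
  exact continuous_restrictToSphere p

theorem hasDerivAt_eval_comp {x : Fin 3 → ℝ → ℝ} {x' : Fin 3 → ℝ} {s : ℝ}
    (hx : ∀ i, HasDerivAt (x i) (x' i) s) (p : MvPolynomial (Fin 3) 𝕜) :
    HasDerivAt (fun t => eval (fun i => ((x i t : ℝ) : 𝕜)) p)
      (∑ i, ((x' i : ℝ) : 𝕜) * eval (fun i => ((x i s : ℝ) : 𝕜)) (pderiv i p)) s := by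
  induction p using MvPolynomial.induction_on with
  | C a => simpa using hasDerivAt_const s a
  | add p q hp hq =>
    simp only [map_add, mul_add, Finset.sum_add_distrib]
    exact hp.add hq
  | mul_X p m hp =>
    have hm : HasDerivAt (fun t => ((x m t : ℝ) : 𝕜)) ((x' m : ℝ) : 𝕜) s :=
      (RCLike.ofRealCLM (K := 𝕜)).hasFDerivAt.comp_hasDerivAt s (hx m)
    simp only [map_mul, eval_X]
    refine (hp.mul hm).congr_deriv ?_
    simp only [pderiv_mul, pderiv_X, map_add, map_mul, eval_X, mul_add, Finset.sum_add_distrib,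
      Finset.sum_mul, Pi.single_apply, mul_assoc]
    congr 1
    rw [Finset.sum_eq_single m]
    · simp [mul_comm]
    · intro b _ hb
      simp [Ne.symm hb]
    · simp

theorem hasDerivAt_coordRotation (i a b : Fin 3) (s : ℝ) :
    HasDerivAt (fun t => (coordRotation i t).1 a b)
      (if a = i then -(coordRotation i s).1 (i + 1) b
        else if a = i + 1 then (coordRotation i s).1 i b else 0) s := by
  have hs := Real.hasDerivAt_sin s
  have hc := Real.hasDerivAt_cos s
  have h0 := hasDerivAt_const (𝕜 := ℝ) s (0 : ℝ)
  have h1 := hasDerivAt_const (𝕜 := ℝ) s (1 : ℝ)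
  fin_cases i <;> fin_cases a <;> fin_cases b <;> simp [coordRotation] <;>
    first | exact hs | exact hc | exact hs.neg | exact hc.neg | exact h0 | exact h1

theorem hasDerivAt_rotS_coordRotation (i a : Fin 3) (n : S2) (s : ℝ) :
    HasDerivAt (fun t => (rotS (coordRotation i t) n).1 a)
      (if a = i then -(rotS (coordRotation i s) n).1 (i + 1)
        else if a = i + 1 then (rotS (coordRotation i s) n).1 i else 0) s := by
  simp only [rotS, rot_apply]
  refine (HasDerivAt.fun_sum fun b _ =>
    (hasDerivAt_coordRotation i a b s).mul_const (n.1 b)).congr_deriv ?_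
  split_ifs <;> simp

theorem restrictToSphere_apply (p : MvPolynomial (Fin 3) 𝕜) (n : S2) :
    restrictToSphere 𝕜 p n = eval (fun i => ((n.1 i : ℝ) : 𝕜)) p := rfl

/-- `angularDeriv i` generates the flow `coordRotation i`; this turns an algebraic derivation into a
derivative along orbits. -/
theorem hasDerivAt_restrictToSphere_coordRotation (i : Fin 3) (n : S2) (s : ℝ)
    (p : MvPolynomial (Fin 3) 𝕜) :
    HasDerivAt (fun t => restrictToSphere 𝕜 p (rotS (coordRotation i t) n))
      (restrictToSphere 𝕜 (angularDeriv i p) (rotS (coordRotation i s) n)) s := by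
  refine (hasDerivAt_eval_comp (fun a => hasDerivAt_rotS_coordRotation i a n s) p).congr_deriv ?_
  simp only [restrictToSphere_apply, angularDeriv_apply, map_sub, map_mul, eval_X,
    Fin.sum_univ_three]
  fin_cases i <;> simp <;> ring

theorem continuous_coordRotation (i : Fin 3) : Continuous (coordRotation i) :=
  Continuous.subtype_mk (continuous_matrix fun a b =>
    continuous_iff_continuousAt.2 fun s => (hasDerivAt_coordRotation i a b s).continuousAt) _

theorem integrable_of_continuous {X : Type*} [NormedAddCommGroup X] {f : S2 → X}
    (hf : Continuous f) : Integrable f sphereMeasure :=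
  hf.integrable_of_hasCompactSupport (HasCompactSupport.of_compactSpace f)

/-- Along each closed orbit the derivative integrates to zero over a period. Integrating over the
sphere too and exchanging the integrals, invariance of the measure gives 2π times the integral in
question. -/
theorem integral_restrictToSphere_angularDeriv (i : Fin 3) (p : MvPolynomial (Fin 3) 𝕜) :
    ∫ n, restrictToSphere 𝕜 (angularDeriv i p) n ∂sphereMeasure = 0 := by
  set q := restrictToSphere 𝕜 (angularDeriv i p) with hq
  have hqc : Continuous q := continuous_restrictToSphere _
  have hjoint : Continuous fun z : ℝ × S2 => q (rotS (coordRotation i z.1) z.2) :=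
    hqc.comp (continuous_rotS.comp
      (((continuous_coordRotation i).comp continuous_fst).prodMk continuous_snd))
  have h1 : ∀ n, ∫ s in (0)..(2 * Real.pi), q (rotS (coordRotation i s) n) = 0 := by
    intro n
    rw [intervalIntegral.integral_eq_sub_of_hasDerivAt
      (fun s _ => hasDerivAt_restrictToSphere_coordRotation i n s p)
      ((hjoint.comp (Continuous.prodMk_left n)).intervalIntegrable _ _), coordRotation_periodic, sub_self]
  have h2 : ∀ s, ∫ n, q (rotS (coordRotation i s) n) ∂sphereMeasure
      = ∫ n, q n ∂sphereMeasure := fun s =>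
    (measurePreserving_rotS _).integral_comp (measurableEmbedding_rotS _) q
  have hint : Integrable (Function.uncurry fun (s : ℝ) (n : S2) => q (rotS (coordRotation i s) n))
      ((volume.restrict (Set.Ioc 0 (2 * Real.pi))).prod sphereMeasure) := by
    obtain ⟨C, hC⟩ := (isCompact_range hqc).isBounded.exists_norm_le
    refine Integrable.of_bound hjoint.aestronglyMeasurable C (ae_of_all _ fun z => ?_)
    exact hC _ ⟨_, rfl⟩
  have h3 := integral_integral_swap hint
  simp only [h2] at h3
  have h4 : ∀ n, ∫ s in Set.Ioc 0 (2 * Real.pi), q (rotS (coordRotation i s) n) = 0 := by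
    intro n
    rw [← intervalIntegral.integral_of_le (by positivity), h1]
  simp only [h4, integral_const, smul_zero] at h3
  refine (smul_eq_zero.1 h3).resolve_left ?_
  simp [Real.pi_pos.le, Real.pi_ne_zero]

/-- Integration by parts on the sphere; it makes the Casimir operator symmetric for the bilinear
pairing. -/
theorem integral_angularDeriv_mul (i : Fin 3) (p q : MvPolynomial (Fin 3) 𝕜) :
    ∫ n, restrictToSphere 𝕜 (angularDeriv i p * q) n ∂sphereMeasure
      = -∫ n, restrictToSphere 𝕜 (p * angularDeriv i q) n ∂sphereMeasure := by
  have h := integral_restrictToSphere_angularDeriv i (p * q)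
  rw [Derivation.leibniz, map_add] at h
  simp only [Pi.add_apply, smul_eq_mul] at h
  rw [integral_add (integrable_of_continuous (continuous_restrictToSphere _))
    (integrable_of_continuous (continuous_restrictToSphere _)), mul_comm q] at h
  exact eq_neg_of_add_eq_zero_right h

theorem integral_mul_eq_zero_of_harmonic {ℓ m : ℕ} (hne : ℓ ≠ m) {p q : MvPolynomial (Fin 3) 𝕜}
    (hp : p ∈ harmonicPoly 𝕜 ℓ) (hq : q ∈ harmonicPoly 𝕜 m) :
    ∫ n, restrictToSphere 𝕜 (p * q) n ∂sphereMeasure = 0 := by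
  let I : MvPolynomial (Fin 3) 𝕜 →ₗ[𝕜] 𝕜 :=
    { toFun := fun p => ∫ n, restrictToSphere 𝕜 p n ∂sphereMeasure
      map_add' := fun p q => by
        rw [map_add]
        exact integral_add (integrable_of_continuous (continuous_restrictToSphere _))
          (integrable_of_continuous (continuous_restrictToSphere _))
      map_smul' := fun c p => by
        rw [map_smul]
        exact integral_const_mul c _ }
  have key : ∀ i p q, I (angularDeriv i p * q) = -I (p * angularDeriv i q) :=
    integral_angularDeriv_mul
  have h : I ((∑ i, angularDeriv i (angularDeriv i p)) * q)
      = I (p * ∑ i, angularDeriv i (angularDeriv i q)) := by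
    simp only [Finset.sum_mul, Finset.mul_sum, map_sum]
    exact Finset.sum_congr rfl fun i _ => by rw [key, key, neg_neg]
  rw [sum_angularDeriv_sq_of_harmonic hp.1 hp.2, sum_angularDeriv_sq_of_harmonic hq.1 hq.2,
    neg_mul, mul_neg, map_neg, map_neg, smul_mul_assoc, mul_smul_comm, map_nsmul, map_nsmul,
    neg_inj, ← sub_eq_zero, ← Nat.cast_smul_eq_nsmul 𝕜, ← Nat.cast_smul_eq_nsmul 𝕜, ← sub_smul]
    at h
  refine (smul_eq_zero.1 h).resolve_left ?_
  rw [sub_eq_zero, Nat.cast_inj]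
  -- The eigenvalues differ because d(d+1) is strictly increasing in d.
  rcases lt_or_gt_of_ne hne with h | h <;> nlinarith

/-- The Laplacian has real coefficients. Hence orthogonality for the bilinear pairing passes to the
Hermitian one. -/
theorem map_conj_mem_harmonicPoly {ℓ : ℕ} {p : MvPolynomial (Fin 3) 𝕜}
    (hp : p ∈ harmonicPoly 𝕜 ℓ) : MvPolynomial.map (starRingEnd 𝕜) p ∈ harmonicPoly 𝕜 ℓ := by
  refine ⟨IsHomogeneous.map hp.1 _, ?_⟩
  have h := congrArg (MvPolynomial.map (starRingEnd 𝕜)) (mem_harmonicPoly.1 hp).2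
  rw [polyLaplacian_apply] at h
  change polyLaplacian 𝕜 _ = 0
  rw [polyLaplacian_apply]
  simpa [pderiv_map] using h

theorem restrictToSphere_map_conj (p : MvPolynomial (Fin 3) 𝕜) (n : S2) :
    restrictToSphere 𝕜 (MvPolynomial.map (starRingEnd 𝕜) p) n = starRingEnd 𝕜 (restrictToSphere 𝕜 p n) := by
  induction p using MvPolynomial.induction_on with
  | C a => simp [restrictToSphere_apply]
  | add p q hp hq => simp only [map_add, Pi.add_apply, hp, hq]
  | mul_X p i hp =>
    rw [map_mul, restrictToSphere_mul, restrictToSphere_mul, hp, map_mul]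
    simp [restrictToSphere_apply]

/-- Spherical harmonics of different degrees are orthogonal. -/
theorem integral_conj_mul_eq_zero_of_ne {ℓ m : ℕ} (hne : ℓ ≠ m) {y z : S2 → 𝕜}
    (hy : y ∈ sphericalHarmonics 𝕜 ℓ) (hz : z ∈ sphericalHarmonics 𝕜 m) :
    ∫ n, starRingEnd 𝕜 (y n) * z n ∂sphereMeasure = 0 := by
  obtain ⟨p, hp, rfl⟩ := hy
  obtain ⟨q, hq, rfl⟩ := hz
  simp only [← restrictToSphere_map_conj, ← restrictToSphere_mul]
  exact integral_mul_eq_zero_of_harmonic hne (map_conj_mem_harmonicPoly hp) hq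

end Orthogonality

/-! ### Completeness and scalar harmonic expansions -/

section HarmonicExpansion

variable {𝕜 : Type*} [RCLike 𝕜]

theorem memLp_two_of_continuous {X : Type*} [NormedAddCommGroup X] {f : S2 → X}
    (hf : Continuous f) : MemLp f 2 sphereMeasure :=
  hf.memLp_of_hasCompactSupport (HasCompactSupport.of_compactSpace f)

theorem memLp_of_mem_sphericalHarmonics {ℓ : ℕ} {y : S2 → 𝕜} (hy : y ∈ sphericalHarmonics 𝕜 ℓ) :
    MemLp y 2 sphereMeasure :=
  memLp_two_of_continuous (continuous_of_mem_sphericalHarmonics hy)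

/-- The class in `L²(S²)` of a spherical harmonic. -/
def harmonicLp (𝕜 : Type*) [RCLike 𝕜] (ℓ : ℕ) :
    sphericalHarmonics 𝕜 ℓ →ₗ[𝕜] Lp 𝕜 2 sphereMeasure where
  toFun y := (memLp_of_mem_sphericalHarmonics y.2).toLp y.1
  map_add' _ _ := rfl
  map_smul' _ _ := rfl

theorem coeFn_harmonicLp {ℓ : ℕ} (y : sphericalHarmonics 𝕜 ℓ) :
    harmonicLp 𝕜 ℓ y =ᵐ[sphereMeasure] y.1 :=
  (memLp_of_mem_sphericalHarmonics y.2).coeFn_toLp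

theorem coeFn_sum_harmonicLp (s : Finset ℕ) (y : ∀ ℓ, sphericalHarmonics 𝕜 ℓ) :
    ⇑(∑ ℓ ∈ s, harmonicLp 𝕜 ℓ (y ℓ)) =ᵐ[sphereMeasure] fun n => ∑ ℓ ∈ s, (y ℓ).1 n := by
  refine (Lp.coeFn_finsetSum _ _).trans ?_
  have h : ∀ᵐ n ∂sphereMeasure, ∀ ℓ, harmonicLp 𝕜 ℓ (y ℓ) n = (y ℓ).1 n :=
    ae_all_iff.2 fun ℓ => coeFn_harmonicLp _
  filter_upwards [h] with n hn
  simp [hn]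

/-- Continuous functions that agree almost everywhere agree everywhere, as the surface measure
charges every nonempty open set. -/
theorem harmonicLp_injective (ℓ : ℕ) : Function.Injective (harmonicLp 𝕜 ℓ) := by
  intro y z h
  have h1 : y.1 =ᵐ[sphereMeasure] z.1 := by
    filter_upwards [coeFn_harmonicLp y, coeFn_harmonicLp z] with n hy hz
    rw [← hy, ← hz, h]
  exact Subtype.ext (Measure.eq_of_ae_eq h1 (continuous_of_mem_sphericalHarmonics y.2)
    (continuous_of_mem_sphericalHarmonics z.2))

theorem inner_harmonicLp {ℓ : ℕ} (y : sphericalHarmonics 𝕜 ℓ) {g : S2 → 𝕜}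
    (hg : MemLp g 2 sphereMeasure) :
    inner 𝕜 (harmonicLp 𝕜 ℓ y) (hg.toLp g)
      = ∫ n, starRingEnd 𝕜 (y.1 n) * g n ∂sphereMeasure := by
  rw [L2.inner_def]
  refine integral_congr_ae ?_
  filter_upwards [coeFn_harmonicLp y, hg.coeFn_toLp] with n hy hg
  rw [hy, hg, RCLike.inner_apply, mul_comm]

theorem inner_harmonicLp_of_ne {ℓ m : ℕ} (hne : ℓ ≠ m) (y : sphericalHarmonics 𝕜 ℓ)
    (z : sphericalHarmonics 𝕜 m) : inner 𝕜 (harmonicLp 𝕜 ℓ y) (harmonicLp 𝕜 m z) = 0 :=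
  (inner_harmonicLp y (memLp_of_mem_sphericalHarmonics z.2)).trans (integral_conj_mul_eq_zero_of_ne hne y.2 z.2)

/-- The star subalgebra of the continuous functions on `S²` that are restrictions of polynomials. -/
def spherePolynomials (𝕜 : Type*) [RCLike 𝕜] : StarSubalgebra 𝕜 C(S2, 𝕜) where
  carrier := {f | ∃ p, ⇑f = restrictToSphere 𝕜 p}
  mul_mem' := by
    rintro f g ⟨p, hp⟩ ⟨q, hq⟩
    exact ⟨p * q, funext fun n => by
      rw [restrictToSphere_mul, ← hp, ← hq, ContinuousMap.mul_apply]⟩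
  add_mem' := by
    rintro f g ⟨p, hp⟩ ⟨q, hq⟩
    exact ⟨p + q, by rw [map_add, ← hp, ← hq, ContinuousMap.coe_add]⟩
  algebraMap_mem' c := ⟨MvPolynomial.C c, funext fun n => by simp [restrictToSphere_apply]⟩
  star_mem' := by
    rintro f ⟨p, hp⟩
    exact ⟨MvPolynomial.map (starRingEnd 𝕜) p, funext fun n => by
      rw [restrictToSphere_map_conj, ← hp]
      rfl⟩

theorem spherePolynomials_separatesPoints : (spherePolynomials 𝕜).SeparatesPoints := by
  intro x y hxy
  have : ∃ i, x.1 i ≠ y.1 i := by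
    by_contra! h
    exact hxy (Subtype.ext (PiLp.ext h))
  obtain ⟨i, hi⟩ := this
  refine ⟨_, ⟨⟨_, continuous_restrictToSphere (MvPolynomial.X i)⟩, ⟨_, rfl⟩, rfl⟩, ?_⟩
  simpa [restrictToSphere_apply] using hi

/-- Polynomials are uniformly dense in C(S²) by Stone-Weierstrass, C(S²) is dense in L², and on the
sphere every polynomial is a finite sum of harmonics. -/
theorem topologicalClosure_iSup_range_harmonicLp :
    ⊤ ≤ (⨆ ℓ, LinearMap.range (harmonicLp 𝕜 ℓ)).topologicalClosure := by
  set T := ContinuousMap.toLp (E := 𝕜) 2 sphereMeasure 𝕜 with hT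
  have hrange : ∀ f ∈ spherePolynomials 𝕜, T f ∈ ⨆ ℓ, LinearMap.range (harmonicLp 𝕜 ℓ) := by
    rintro f ⟨p, hp⟩
    have hmem := restrictToSphere_mem_iSup p
    rw [← hp, Submodule.mem_iSup_iff_exists_finsupp] at hmem
    obtain ⟨u, hu, hsum⟩ := hmem
    have : T f = ∑ ℓ ∈ u.support, harmonicLp 𝕜 ℓ ⟨u ℓ, hu ℓ⟩ := by
      apply Lp.ext
      refine (ContinuousMap.coeFn_toLp (p := 2) (𝕜 := 𝕜) sphereMeasure f).trans ?_
      refine EventuallyEq.trans (Eq.eventuallyEq ?_) (coeFn_sum_harmonicLp _ _).symm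
      rw [← hsum]
      ext n
      simp [Finsupp.sum]
    rw [this]
    exact Submodule.sum_mem _ fun ℓ _ => Submodule.mem_iSup_of_mem ℓ ⟨_, rfl⟩
  have hdense := ContinuousMap.starSubalgebra_topologicalClosure_eq_top_of_separatesPoints
    (spherePolynomials 𝕜) spherePolynomials_separatesPoints
  have h1 : Dense (spherePolynomials 𝕜 : Set C(S2, 𝕜)) := by
    intro f
    have : f ∈ (spherePolynomials 𝕜).topologicalClosure := hdense ▸ StarSubalgebra.mem_top
    exact this
  have h2 : Dense (T '' (spherePolynomials 𝕜 : Set C(S2, 𝕜))) :=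
    (ContinuousMap.toLp_denseRange 𝕜 sphereMeasure 𝕜 (p := 2) (by norm_num)).dense_image T.continuous h1
  intro x _
  exact closure_mono (Set.image_subset_iff.2 hrange) (h2 x)

variable {ι : ℕ → Type*} [∀ ℓ, Fintype (ι ℓ)]

theorem sum_starProjection_eq [∀ ℓ, FiniteDimensional 𝕜 (sphericalHarmonics 𝕜 ℓ)]
    (s : Finset ℕ) (g : Lp 𝕜 2 sphereMeasure)
    [(s.sup fun ℓ => LinearMap.range (harmonicLp 𝕜 ℓ)).HasOrthogonalProjection] :
    (s.sup fun ℓ => LinearMap.range (harmonicLp 𝕜 ℓ)).starProjection g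
      = ∑ ℓ ∈ s, (LinearMap.range (harmonicLp 𝕜 ℓ)).starProjection g := by
  have hmem : ∀ ℓ, (LinearMap.range (harmonicLp 𝕜 ℓ)).starProjection g
      ∈ LinearMap.range (harmonicLp 𝕜 ℓ) := fun ℓ => Submodule.starProjection_apply_mem _ _
  refine Submodule.eq_starProjection_of_mem_orthogonal ?_ ?_
  · exact Submodule.sum_mem _ fun ℓ hℓ =>
      (Finset.le_sup (f := fun ℓ => LinearMap.range (harmonicLp 𝕜 ℓ)) hℓ) (hmem ℓ)
  · rw [Submodule.mem_orthogonal]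
    suffices (s.sup fun ℓ => LinearMap.range (harmonicLp 𝕜 ℓ)) ≤
        (𝕜 ∙ (g - ∑ ℓ ∈ s, (LinearMap.range (harmonicLp 𝕜 ℓ)).starProjection g))ᗮ from
      fun u hu => Submodule.mem_orthogonal_singleton_iff_inner_left.1 (this hu)
    refine Finset.sup_le fun m hm => ?_
    rintro _ ⟨y, rfl⟩
    rw [Submodule.mem_orthogonal_singleton_iff_inner_left, inner_sub_right, inner_sum,
      Finset.sum_eq_single m, ← inner_sub_right]
    · exact Submodule.inner_right_of_mem_orthogonal (LinearMap.mem_range_self _ y)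
        (Submodule.sub_starProjection_mem_orthogonal g)
    · intro ℓ _ hne
      obtain ⟨z, hz⟩ := hmem ℓ
      rw [← hz, inner_harmonicLp_of_ne hne.symm]
    · exact fun h => absurd hm h

theorem tendsto_sum_starProjection [∀ ℓ, FiniteDimensional 𝕜 (sphericalHarmonics 𝕜 ℓ)]
    (g : Lp 𝕜 2 sphereMeasure) :
    Tendsto (fun L => ∑ ℓ ∈ Finset.range L, (LinearMap.range (harmonicLp 𝕜 ℓ)).starProjection g)
      atTop (𝓝 g) := by
  set U : ℕ → Submodule 𝕜 (Lp 𝕜 2 sphereMeasure) :=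
    fun L => (Finset.range L).sup fun ℓ => LinearMap.range (harmonicLp 𝕜 ℓ) with hU
  have : ∀ L, FiniteDimensional 𝕜 (U L) := fun L => Submodule.finiteDimensional_finset_sup _ _
  have hmono : Monotone U := fun a b hab => Finset.sup_mono (Finset.range_mono hab)
  have hle : (⨆ ℓ, LinearMap.range (harmonicLp 𝕜 ℓ)) ≤ ⨆ L, U L :=
    iSup_le fun ℓ => le_trans (Finset.le_sup (f := fun ℓ => LinearMap.range (harmonicLp 𝕜 ℓ))
      (Finset.self_mem_range_succ ℓ)) (le_iSup U (ℓ + 1))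
  have h := Submodule.starProjection_tendsto_self U hmono g
    (topologicalClosure_iSup_range_harmonicLp.trans (Submodule.topologicalClosure_mono hle))
  refine h.congr fun L => sum_starProjection_eq _ g

/-- The basis need not be orthonormal, so the coefficients are inner products with the dual basis,
obtained from the coordinate functionals by Riesz representation. -/
theorem exists_starProjection_eq {ℓ : ℕ} {κ : Type*} [Fintype κ]
    (Y : Module.Basis κ 𝕜 (sphericalHarmonics 𝕜 ℓ))
    [(LinearMap.range (harmonicLp 𝕜 ℓ)).HasOrthogonalProjection] :
    ∃ Z : κ → sphericalHarmonics 𝕜 ℓ, ∀ g : Lp 𝕜 2 sphereMeasure,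
      (LinearMap.range (harmonicLp 𝕜 ℓ)).starProjection g
        = ∑ k, inner 𝕜 (harmonicLp 𝕜 ℓ (Z k)) g • harmonicLp 𝕜 ℓ (Y k) := by
  have : FiniteDimensional 𝕜 (sphericalHarmonics 𝕜 ℓ) := Y.finiteDimensional_of_finite
  obtain ⟨e, hr⟩ : ∃ e : sphericalHarmonics 𝕜 ℓ ≃ₗ[𝕜] LinearMap.range (harmonicLp 𝕜 ℓ),
      ∀ y, (e y : Lp 𝕜 2 sphereMeasure) = harmonicLp 𝕜 ℓ y :=
    ⟨LinearEquiv.ofInjective (harmonicLp 𝕜 ℓ) (harmonicLp_injective ℓ), fun y =>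
      LinearEquiv.ofInjective_apply (harmonicLp 𝕜 ℓ) y⟩
  have hZ : ∀ k, ∃ z : sphericalHarmonics 𝕜 ℓ, ∀ y,
      inner 𝕜 (harmonicLp 𝕜 ℓ z) (harmonicLp 𝕜 ℓ y) = Y.repr y k := by
    intro k
    let φ : LinearMap.range (harmonicLp 𝕜 ℓ) →L[𝕜] 𝕜 :=
      LinearMap.toContinuousLinearMap (Y.coord k ∘ₗ e.symm.toLinearMap)
    refine ⟨e.symm
      ((InnerProductSpace.toDual 𝕜 (LinearMap.range (harmonicLp 𝕜 ℓ))).symm φ), fun y => ?_⟩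
    have h := InnerProductSpace.toDual_symm_apply (𝕜 := 𝕜) (x := e y) (y := φ)
    rw [Submodule.coe_inner] at h
    have h2 : ∀ x : LinearMap.range (harmonicLp 𝕜 ℓ), harmonicLp 𝕜 ℓ (e.symm x) = x := fun x =>
      (hr _).symm.trans (congrArg Subtype.val (e.apply_symm_apply x))
    rw [h2, ← hr]
    refine h.trans ?_
    simp [φ]
  choose Z hZ using hZ
  refine ⟨Z, fun g => ?_⟩
  obtain ⟨y, hy⟩ : (LinearMap.range (harmonicLp 𝕜 ℓ)).starProjection g ∈
      LinearMap.range (harmonicLp 𝕜 ℓ) := Submodule.starProjection_apply_mem _ _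
  rw [← hy]
  conv_lhs => rw [← Y.sum_repr y, map_sum]
  refine Finset.sum_congr rfl fun k _ => ?_
  rw [map_smul, ← hZ, hy, ← Submodule.inner_starProjection_left_eq_right]
  congr 2
  exact Submodule.starProjection_eq_self_iff.2 ⟨_, rfl⟩

/-- Scalar square integrable functions on the sphere are the sums of their expansions into spherical
harmonics; the coefficients are inner products with a dual family. -/
theorem exists_harmonic_expansion (Y : ∀ ℓ, Module.Basis (ι ℓ) 𝕜 (sphericalHarmonics 𝕜 ℓ)) :
    ∃ Z : ∀ ℓ, ι ℓ → S2 → 𝕜, (∀ ℓ k, Continuous (Z ℓ k)) ∧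
      ∀ g : S2 → 𝕜, MemLp g 2 sphereMeasure → Tendsto (fun L => eLpNorm (fun n => g n -
        ∑ ℓ ∈ Finset.range L, ∑ k, (Y ℓ k).1 n * ∫ m, Z ℓ k m * g m ∂sphereMeasure)
        2 sphereMeasure) atTop (𝓝 0) := by
  have hfin : ∀ ℓ, FiniteDimensional 𝕜 (sphericalHarmonics 𝕜 ℓ) :=
    fun ℓ => (Y ℓ).finiteDimensional_of_finite
  choose Z hZ using fun ℓ => exists_starProjection_eq (Y ℓ)
  refine ⟨fun ℓ k n => starRingEnd 𝕜 ((Z ℓ k).1 n), fun ℓ k =>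
    RCLike.continuous_conj.comp (continuous_of_mem_sphericalHarmonics (Z ℓ k).2), fun g hg => ?_⟩
  have h := tendsto_sum_starProjection (hg.toLp g)
  rw [Lp.tendsto_Lp_iff_tendsto_eLpNorm] at h
  refine h.congr fun L => ?_
  have hproj : ∀ ℓ, (LinearMap.range (harmonicLp 𝕜 ℓ)).starProjection (hg.toLp g)
      = harmonicLp 𝕜 ℓ (∑ k, (∫ m, starRingEnd 𝕜 ((Z ℓ k).1 m) * g m ∂sphereMeasure) • Y ℓ k) := by
    intro ℓ
    rw [hZ, map_sum]
    exact Finset.sum_congr rfl fun k _ => by rw [map_smul, inner_harmonicLp]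
  rw [← eLpNorm_neg]
  refine eLpNorm_congr_ae ?_
  simp only [hproj]
  filter_upwards [coeFn_sum_harmonicLp (Finset.range L) fun ℓ =>
    ∑ k, (∫ m, starRingEnd 𝕜 ((Z ℓ k).1 m) * g m ∂sphereMeasure) • Y ℓ k] with n hn
  rw [Pi.neg_apply, Pi.sub_apply, hn, neg_sub]
  simp [mul_comm]

/-- By orthogonality, pairing the partial sums with the m-th term gives its squared norm as soon as
L > m, and the limit of these pairings is zero. -/
theorem eq_zero_of_tendsto_sum_harmonics {y : ∀ _ : ℕ, S2 → 𝕜}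
    (hy : ∀ ℓ, y ℓ ∈ sphericalHarmonics 𝕜 ℓ)
    (h : Tendsto (fun L => eLpNorm (fun n => ∑ ℓ ∈ Finset.range L, y ℓ n) 2 sphereMeasure)
      atTop (𝓝 0)) (m : ℕ) : y m = 0 := by
  set z : ∀ ℓ, sphericalHarmonics 𝕜 ℓ := fun ℓ => ⟨y ℓ, hy ℓ⟩ with hz
  have h1 : Tendsto (fun L => ∑ ℓ ∈ Finset.range L, harmonicLp 𝕜 ℓ (z ℓ)) atTop (𝓝 0) := by
    rw [Lp.tendsto_Lp_iff_tendsto_eLpNorm']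
    refine h.congr fun L => eLpNorm_congr_ae ?_
    filter_upwards [coeFn_sum_harmonicLp (Finset.range L) z,
      Lp.coeFn_zero 𝕜 2 sphereMeasure] with n hn h0
    rw [Pi.sub_apply, hn, h0]
    simp [hz]
  have h2 : Tendsto (fun L => inner 𝕜 (harmonicLp 𝕜 m (z m))
      (∑ ℓ ∈ Finset.range L, harmonicLp 𝕜 ℓ (z ℓ))) atTop (𝓝 0) := by
    have := (tendsto_const_nhds (x := harmonicLp 𝕜 m (z m))).inner (𝕜 := 𝕜) h1
    rwa [inner_zero_right] at this
  have h3 : ∀ᶠ L in atTop, inner 𝕜 (harmonicLp 𝕜 m (z m))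
      (∑ ℓ ∈ Finset.range L, harmonicLp 𝕜 ℓ (z ℓ))
        = inner 𝕜 (harmonicLp 𝕜 m (z m)) (harmonicLp 𝕜 m (z m)) := by
    filter_upwards [eventually_gt_atTop m] with L hL
    rw [inner_sum, Finset.sum_eq_single m]
    · exact fun ℓ _ hne => inner_harmonicLp_of_ne hne.symm _ _
    · exact fun hm => absurd (Finset.mem_range.2 hL) hm
  have h4 := tendsto_nhds_unique (h2.congr' h3) tendsto_const_nhds
  have h5 : z m = 0 := harmonicLp_injective m (by
    rw [map_zero]
    exact inner_self_eq_zero.1 h4.symm)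
  exact congrArg Subtype.val h5

end HarmonicExpansion

/-! ### Expansions of vector-valued functions -/

section VectorExpansion

variable {𝕜 : Type*} [RCLike 𝕜] {ι : ℕ → Type*} [∀ ℓ, Fintype (ι ℓ)]
  {X : Type*} [NormedAddCommGroup X] [NormedSpace 𝕜 X]

theorem tendsto_eLpNorm_zero_of_le {α F G : Type*} [MeasurableSpace α] [NormedAddCommGroup F]
    [NormedAddCommGroup G] {μ : Measure α} {p : ℝ≥0∞} {u : ℕ → α → F} {v : ℕ → α → G} (C : ℝ)
    (h : ∀ L x, ‖v L x‖ ≤ C * ‖u L x‖) (hu : Tendsto (fun L => eLpNorm (u L) p μ) atTop (𝓝 0)) :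
    Tendsto (fun L => eLpNorm (v L) p μ) atTop (𝓝 0) := by
  have h1 : Tendsto (fun L => ENNReal.ofReal C * eLpNorm (u L) p μ) atTop (𝓝 0) := by
    simpa using ENNReal.Tendsto.const_mul hu (Or.inr ENNReal.ofReal_ne_top)
  exact tendsto_of_tendsto_of_tendsto_of_le_of_le tendsto_const_nhds h1 (fun _ => zero_le)
    fun L => eLpNorm_le_mul_eLpNorm_of_ae_le_mul (ae_of_all _ (h L)) p

/-- Square integrable functions on the sphere with values in a finite-dimensional space are the
sums of their expansions into spherical harmonics. -/
theorem exists_vector_harmonic_expansion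
    (Y : ∀ ℓ, Module.Basis (ι ℓ) 𝕜 (sphericalHarmonics 𝕜 ℓ)) (X : Type*) [NormedAddCommGroup X]
    [NormedSpace 𝕜 X] [NormedSpace ℝ X] [FiniteDimensional 𝕜 X] :
    ∃ Z : ∀ ℓ, ι ℓ → S2 → 𝕜, (∀ ℓ k, Continuous (Z ℓ k)) ∧
      ∀ g : S2 → X, MemLp g 2 sphereMeasure → Tendsto (fun L : ℕ => eLpNorm (fun n => g n -
        ∑ ℓ ∈ Finset.range L, ∑ k, (Y ℓ k).1 n • ∫ m, Z ℓ k m • g m ∂sphereMeasure)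
        2 sphereMeasure) atTop (𝓝 0) := by
  obtain ⟨Z, hZ, hexp⟩ := exists_harmonic_expansion Y
  refine ⟨Z, hZ, fun g hg => ?_⟩
  have : CompleteSpace X := FiniteDimensional.complete 𝕜 X
  -- The scalar expansion is applied to each coordinate; its dual family Z depends neither on the
  -- function nor on the coordinate.
  set b := Module.finBasis 𝕜 X with hb
  set ξ : ∀ _, X →L[𝕜] 𝕜 := fun j => LinearMap.toContinuousLinearMap (b.coord j) with hξ
  have hrec : ∀ x, ∑ j, ξ j x • b j = x := b.sum_repr
  have hξg : ∀ j, MemLp (fun n => ξ j (g n)) 2 sphereMeasure := fun j => (ξ j).comp_memLp' hg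
  have hint : ∀ ℓ k, Integrable (fun m => Z ℓ k m • g m) sphereMeasure := fun ℓ k =>
    memLp_one_iff_integrable.1 (hg.smul (memLp_two_of_continuous (hZ ℓ k)))
  set u : ∀ (_ : ℕ) (_ : Fin (Module.finrank 𝕜 X)), S2 → 𝕜 := fun L j n => ξ j (g n) -
    ∑ ℓ ∈ Finset.range L, ∑ k, (Y ℓ k).1 n * ∫ m, Z ℓ k m * ξ j (g m) ∂sphereMeasure with hu
  have hcoord : ∀ L j n, ξ j (g n - ∑ ℓ ∈ Finset.range L, ∑ k, (Y ℓ k).1 n •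
      ∫ m, Z ℓ k m • g m ∂sphereMeasure) = u L j n := by
    intro L j n
    simp only [map_sub, map_sum, map_smul, smul_eq_mul, hu]
    congr 1
    refine Finset.sum_congr rfl fun ℓ _ => Finset.sum_congr rfl fun k _ => ?_
    rw [← (ξ j).integral_comp_comm (hint ℓ k)]
    simp
  have hsum : ∀ L, (fun n => g n - ∑ ℓ ∈ Finset.range L, ∑ k, (Y ℓ k).1 n •
      ∫ m, Z ℓ k m • g m ∂sphereMeasure) = ∑ j, fun n => u L j n • b j := by
    intro L
    ext n
    rw [Finset.sum_apply, ← hrec (g n - _)]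
    exact Finset.sum_congr rfl fun j _ => by rw [hcoord]
  have hmeas : ∀ L j, AEStronglyMeasurable (fun n => u L j n • b j) sphereMeasure := by
    intro L j
    refine AEStronglyMeasurable.smul_const ((hξg j).1.sub ?_) _
    refine Continuous.aestronglyMeasurable ?_
    exact continuous_finsetSum _ fun ℓ _ => continuous_finsetSum _ fun k _ =>
      (continuous_of_mem_sphericalHarmonics (Y ℓ k).2).mul continuous_const
  simp only [hsum]
  have h0 : ∀ j, Tendsto (fun L => eLpNorm (fun n => u L j n • b j) 2 sphereMeasure)
      atTop (𝓝 0) := fun j =>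
    tendsto_eLpNorm_zero_of_le ‖b j‖ (fun L n => by rw [norm_smul, mul_comm])
      (hexp _ (hξg j))
  have h1 := tendsto_finsetSum Finset.univ fun j _ => h0 j
  rw [Finset.sum_const_zero] at h1
  exact tendsto_of_tendsto_of_tendsto_of_le_of_le tendsto_const_nhds h1 (fun _ => zero_le)
    fun L => eLpNorm_sum_le (fun j _ => hmeas L j) (by norm_num)

theorem coeff_eq_zero_of_tendsto [FiniteDimensional 𝕜 X]
    (Y : ∀ ℓ, Module.Basis (ι ℓ) 𝕜 (sphericalHarmonics 𝕜 ℓ)) {a : ∀ ℓ, ι ℓ → X}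
    (h : Tendsto (fun L => eLpNorm (fun n => ∑ ℓ ∈ Finset.range L, ∑ k, (Y ℓ k).1 n • a ℓ k)
      2 sphereMeasure) atTop (𝓝 0)) (ℓ : ℕ) (k : ι ℓ) : a ℓ k = 0 := by
  rw [← Module.forall_dual_apply_eq_zero_iff 𝕜]
  intro φ
  set ξ : X →L[𝕜] 𝕜 := LinearMap.toContinuousLinearMap φ with hξ
  set y : ∀ ℓ, sphericalHarmonics 𝕜 ℓ := fun ℓ => ∑ k, ξ (a ℓ k) • Y ℓ k with hy
  have h1 : Tendsto (fun L => eLpNorm (fun n => ∑ ℓ ∈ Finset.range L, (y ℓ).1 n)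
      2 sphereMeasure) atTop (𝓝 0) := by
    refine tendsto_eLpNorm_zero_of_le ‖ξ‖ (fun L n => ?_) h
    refine le_of_eq_of_le (congrArg norm ?_) (ξ.le_opNorm _)
    simp only [hy, map_sum, map_smul, smul_eq_mul]
    simp [mul_comm]
  have h2 : y ℓ = 0 :=
    Subtype.ext (eq_zero_of_tendsto_sum_harmonics (fun ℓ => (y ℓ).2) h1 ℓ)
  exact Fintype.linearIndependent_iff.1 (Y ℓ).linearIndependent (fun k => ξ (a ℓ k)) h2 k

end VectorExpansion

/-! ### Strongly continuous finite-dimensional representations -/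

section StronglyContinuous

theorem rep_inv_apply_self {k G M : Type*} [CommSemiring k] [Group G] [AddCommMonoid M] [Module k M]
    (A : Representation k G M) (g : G) (m : M) : A g⁻¹ (A g m) = m := by
  rw [← Module.End.mul_apply, ← map_mul, inv_mul_cancel, map_one, Module.End.one_apply]

theorem rep_self_inv_apply {k G M : Type*} [CommSemiring k] [Group G] [AddCommMonoid M] [Module k M]
    (A : Representation k G M) (g : G) (m : M) : A g (A g⁻¹ m) = m := by
  rw [← Module.End.mul_apply, ← map_mul, mul_inv_cancel, map_one, Module.End.one_apply]

variable {𝕜 : Type*} [RCLike 𝕜] {G : Type*} [Group G]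
  {M : Type*} [NormedAddCommGroup M] [NormedSpace 𝕜 M] [FiniteDimensional 𝕜 M]

theorem continuous_rep_apply [TopologicalSpace G] (A : Representation 𝕜 G M)
    (hA : ∀ m, Continuous fun g => A g m) : Continuous fun p : G × M => A p.1 p.2 := by
  set b := Module.finBasis 𝕜 M with hb
  have h : ∀ p : G × M, A p.1 p.2 = ∑ j, b.coord j p.2 • A p.1 (b j) := by
    intro p
    conv_lhs => rw [← b.sum_repr p.2, map_sum]
    simp only [map_smul, Module.Basis.coord_apply]
  simp only [h]
  refine continuous_finsetSum _ fun j _ => Continuous.smul ?_ ((hA (b j)).comp continuous_fst)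
  exact (LinearMap.continuous_of_finiteDimensional (b.coord j)).comp continuous_snd

/-- A group element acting by a finite-dimensional representation, as a continuous linear
equivalence. -/
def repEquiv (A : Representation 𝕜 G M) (g : G) : M ≃L[𝕜] M :=
  (LinearEquiv.ofLinearMap (A g) (A g⁻¹)
    (by rw [← Module.End.mul_eq_comp, ← map_mul, mul_inv_cancel, map_one]; rfl)
    (by rw [← Module.End.mul_eq_comp, ← map_mul, inv_mul_cancel, map_one]; rfl)
    ).toContinuousLinearEquiv

/-- No integrability is needed, since the group element acts invertibly: if one integrand fails to
be integrable so does the other, and both integrals are zero. -/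
theorem rep_integral_comm {α : Type*} [MeasurableSpace α] {μ : Measure α} [NormedSpace ℝ M]
    (A : Representation 𝕜 G M) (g : G) (f : α → M) :
    ∫ x, A g (f x) ∂μ = A g (∫ x, f x ∂μ) :=
  (repEquiv A g).integral_comp_comm f

end StronglyContinuous

/-! ### Averaging over SO(2) to remove null sets -/

section Averaging

/-- The in-plane rotation with rotation number `z`. -/
def circleRotation : Circle →* SO 2 where
  toFun z := ⟨!![(z : ℂ).re, -(z : ℂ).im; (z : ℂ).im, (z : ℂ).re], by
    have h : (z : ℂ).re * (z : ℂ).re + (z : ℂ).im * (z : ℂ).im = 1 := by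
      rw [← Complex.normSq_apply, Circle.normSq_coe]
    rw [Matrix.mem_specialOrthogonalGroup_iff, Matrix.mem_orthogonalGroup_iff]
    constructor
    · ext i j
      fin_cases i <;> fin_cases j <;> simp [Matrix.mul_apply] <;> linarith
    · rw [Matrix.det_fin_two_of]
      linarith⟩
  map_one' := by
    ext i j
    fin_cases i <;> fin_cases j <;> simp
  map_mul' z w := by
    ext i j
    fin_cases i <;> fin_cases j <;> simp <;> ring

theorem continuous_circleRotation : Continuous circleRotation := by
  refine Continuous.subtype_mk (continuous_matrix fun i j => ?_) _
  have h1 : Continuous fun z : Circle => (z : ℂ).re :=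
    Complex.continuous_re.comp continuous_subtype_val
  have h2 : Continuous fun z : Circle => (z : ℂ).im :=
    Complex.continuous_im.comp continuous_subtype_val
  fin_cases i <;> fin_cases j
  exacts [h1, h2.neg, h2, h1]

theorem circleRotation_surjective : Function.Surjective circleRotation := by
  intro g
  have ho := SO.mul_transpose g
  have hd := (Matrix.mem_specialOrthogonalGroup_iff.1 g.2).2
  rw [Matrix.det_fin_two] at hd
  have h00 := congrFun (congrFun ho 0) 0
  have h01 := congrFun (congrFun ho 0) 1
  have h11 := congrFun (congrFun ho 1) 1
  simp [Matrix.mul_apply] at h00 h01 h11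
  have e1 : g.1 0 0 = g.1 1 1 := by
    linear_combination (-g.1 0 0) * h11 + g.1 1 0 * h01 + g.1 1 1 * hd
  have e2 : g.1 0 1 = -g.1 1 0 := by
    linear_combination (-g.1 0 1) * h11 + g.1 1 1 * h01 - g.1 1 0 * hd
  refine ⟨⟨⟨g.1 0 0, g.1 1 0⟩, ?_⟩, ?_⟩
  · change _ ∈ Metric.sphere (0 : ℂ) 1
    rw [mem_sphere_zero_iff_norm, ← sq_eq_sq₀ (norm_nonneg _) zero_le_one, Complex.sq_norm,
      Complex.normSq_apply]
    simp only
    rw [e2] at h00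
    linarith
  · ext i j
    fin_cases i <;> fin_cases j <;> simp [circleRotation, e1, e2]

/-- The converse of Fubini for null sets requires a measurable set; passing to strongly measurable
representatives makes the equality set measurable. -/
theorem ae_prod_eq_iff {α β M : Type*} [MeasurableSpace α] [MeasurableSpace β]
    [NormedAddCommGroup M] {μ : Measure α} {ν : Measure β} [SFinite μ] [SFinite ν] {f g : α × β → M}
    (hf : AEStronglyMeasurable f (μ.prod ν)) (hg : AEStronglyMeasurable g (μ.prod ν)) :
    (∀ᵐ z ∂μ.prod ν, f z = g z) ↔ ∀ᵐ x ∂μ, ∀ᵐ y ∂ν, f (x, y) = g (x, y) := by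
  refine ⟨Measure.ae_ae_of_ae_prod, fun h => ?_⟩
  have hf' := Measure.ae_ae_of_ae_prod hf.ae_eq_mk
  have hg' := Measure.ae_ae_of_ae_prod hg.ae_eq_mk
  have hset : MeasurableSet {z : α × β | hf.mk f z = hg.mk g z} :=
    StronglyMeasurable.measurableSet_eq_fun hf.stronglyMeasurable_mk hg.stronglyMeasurable_mk
  have h' : ∀ᵐ z ∂μ.prod ν, z ∈ {z : α × β | hf.mk f z = hg.mk g z} := by
    rw [Measure.ae_prod_mem_iff_ae_ae_mem hset]
    filter_upwards [h, hf', hg'] with x hx hfx hgx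
    filter_upwards [hx, hfx, hgx] with y h1 h2 h3
    exact h2.symm.trans (h1.trans h3)
  filter_upwards [h', hf.ae_eq_mk, hg.ae_eq_mk] with z h1 h2 h3
  rw [h2, h3]
  exact h1

theorem ae_ae_eq_comm {α β M : Type*} [MeasurableSpace α] [MeasurableSpace β]
    [NormedAddCommGroup M] {μ : Measure α} {ν : Measure β} [SFinite μ] [SFinite ν] {f g : α × β → M}
    (hf : AEStronglyMeasurable f (μ.prod ν)) (hg : AEStronglyMeasurable g (μ.prod ν)) :
    (∀ᵐ x ∂μ, ∀ᵐ y ∂ν, f (x, y) = g (x, y)) ↔ ∀ᵐ y ∂ν, ∀ᵐ x ∂μ, f (x, y) = g (x, y) := by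
  have h := ae_prod_eq_iff hf.prod_swap hg.prod_swap
  simp only [Prod.swap_prod_mk] at h
  rw [← ae_prod_eq_iff hf hg, ← h]
  exact ⟨fun h => Measure.measurePreserving_swap.quasiMeasurePreserving.ae h,
    fun h => Measure.measurePreserving_swap.quasiMeasurePreserving.ae h⟩

variable {𝕜 : Type*} [RCLike 𝕜]
  {M : Type*} [NormedAddCommGroup M] [NormedSpace 𝕜 M] [NormedSpace ℝ M] [FiniteDimensional 𝕜 M]

/-- A measurable function that is equivariant up to null sets agrees almost everywhere with one
that is equivariant everywhere, namely with its average over a compact group `K` that maps onto the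
rotation group. -/
theorem exists_equivariant_ae_eq_of_surjective {K : Type*} [Group K] [TopologicalSpace K]
    [IsTopologicalGroup K] [SecondCountableTopology K] [MeasurableSpace K] [BorelSpace K]
    (μ : Measure K) [IsProbabilityMeasure μ] [μ.IsMulRightInvariant] {R : K →* SO 2}
    (hR : Continuous R) (hsurj : Function.Surjective R) (A : Representation 𝕜 (SO 2) M)
    (hA : ∀ m, Continuous fun h => A h m) {c : E 2 → M} (hc : AEStronglyMeasurable c volume)
    (hinv : ∀ h, ∀ᵐ r, c (rot h r) = A h (c r)) :
    ∃ c' : E 2 → M, (∀ h r, c' (rot h r) = A h (c' r)) ∧ c' =ᵐ[volume] c := by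
  have : CompleteSpace M := FiniteDimensional.complete 𝕜 M
  -- A strongly measurable representative makes the integrand below jointly measurable.
  obtain ⟨c₁, hc₁, hcc₁⟩ := hc
  have hinv₁ : ∀ h, ∀ᵐ r, c₁ (rot h r) = A h (c₁ r) := by
    intro h
    filter_upwards [hinv h, hcc₁, (rot h).measurePreserving.quasiMeasurePreserving.ae hcc₁]
      with r h1 h2 h3
    rw [← h3, h1, h2]
  set T : K → E 2 → M := fun z r => A (R z)⁻¹ (c₁ (rot (R z) r))
    with hT
  have hTm : StronglyMeasurable (Function.uncurry T) := by
    have h1 : Continuous fun p : K × E 2 => rot (R p.1) p.2 :=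
      continuous_rot.comp ((hR.comp continuous_fst).prodMk continuous_snd)
    have h2 : Continuous fun p : K × M => A (R p.1)⁻¹ p.2 := by
      have := (continuous_rep_apply A hA).comp
        (((hR.comp continuous_inv).comp
          (continuous_fst (X := K) (Y := M))).prodMk continuous_snd)
      simpa [Function.comp_def] using this
    exact h2.comp_stronglyMeasurable
      (measurable_fst.stronglyMeasurable.prodMk (hc₁.comp_measurable h1.measurable))
  have hc₁m : StronglyMeasurable fun p : K × E 2 => c₁ p.2 :=
    hc₁.comp_measurable measurable_snd
  have hae : ∀ᵐ z ∂μ, ∀ᵐ r, T z r = c₁ r := by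
    refine ae_of_all _ fun z => ?_
    filter_upwards [hinv₁ (R z)] with r hr
    rw [hT]
    simp only
    rw [hr, rep_inv_apply_self]
  -- The exceptional set of r depends on z; exchanging the quantifiers gives, for almost every r,
  -- equality for almost every z, so the average over z is c₁ r.
  have hae' := (ae_ae_eq_comm (f := Function.uncurry T) (g := fun p => c₁ p.2)
    hTm.aestronglyMeasurable hc₁m.aestronglyMeasurable).1 hae
  refine ⟨fun r => ∫ z, T z r ∂μ, fun h r => ?_, ?_⟩
  · obtain ⟨w, rfl⟩ := hsurj h
    -- This identity holds at every r, so right invariance of the measure makes the average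
    -- equivariant without exception.
    have hT' : ∀ z, T z (rot (R w) r) = A (R w) (T (z * w) r) := by
      intro z
      simp only [hT]
      rw [map_mul, mul_inv_rev, map_mul, Module.End.mul_apply, rep_self_inv_apply, rot_mul]
    simp only [hT']
    rw [rep_integral_comm, integral_mul_right_eq_self fun z => T z r]
  · filter_upwards [hae', hcc₁] with r hr hcr
    rw [hcr]
    exact (integral_congr_ae hr).trans (by simp)

theorem exists_equivariant_ae_eq (A : Representation 𝕜 (SO 2) M)
    (hA : ∀ m, Continuous fun h => A h m) {c : E 2 → M} (hc : AEStronglyMeasurable c volume)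
    (hinv : ∀ h, ∀ᵐ r, c (rot h r) = A h (c r)) :
    ∃ c' : E 2 → M, (∀ h r, c' (rot h r) = A h (c' r)) ∧ c' =ᵐ[volume] c := by
  let _ : MeasurableSpace Circle := borel Circle
  have : BorelSpace Circle := ⟨rfl⟩
  have : IsProbabilityMeasure (Measure.haarMeasure (⊤ : TopologicalSpace.PositiveCompacts Circle)) :=
    -- Haar measure is normalised on the chosen compact set, here the whole circle.
    ⟨Measure.haarMeasure_self⟩
  exact exists_equivariant_ae_eq_of_surjective (Measure.haarMeasure ⊤) continuous_circleRotation
    circleRotation_surjective A hA hc hinv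

end Averaging

/-! ### Continuity of inversion, the inclusion and the Wigner representation -/

section Continuity

theorem continuous_inv_SO (n : ℕ) : Continuous fun g : SO n => g⁻¹ := by
  refine Continuous.subtype_mk (f := fun g : SO n => star g.1) ?_ _
  exact continuous_subtype_val.matrix_conjTranspose

theorem continuous_inPlane : Continuous inPlane := by
  refine Continuous.subtype_mk (continuous_matrix fun i j => ?_) _
  have h : ∀ a b, Continuous fun h : SO 2 => h.1 a b := fun a b =>
    continuous_subtype_val.matrix_elem a b
  fin_cases i <;> fin_cases j <;> simp [inPlaneMatrix] <;> first | exact h _ _ | fun_prop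

variable {𝕜 : Type*} [RCLike 𝕜] {κ : Type*} [Fintype κ] [DecidableEq κ]

theorem continuous_wignerD {ℓ : ℕ} (Y : Module.Basis κ 𝕜 (sphericalHarmonics 𝕜 ℓ)) (w : κ → 𝕜) :
    Continuous fun g => wignerD Y g w := by
  have : FiniteDimensional 𝕜 (sphericalHarmonics 𝕜 ℓ) := Y.finiteDimensional_of_finite
  refine continuous_pi fun k => ?_
  have h : ∀ g, wignerD Y g w k = ∑ j, Y.coord j (harmonicComp ℓ g (Y k)) * w j := by
    intro g
    change ((LinearMap.toMatrix Y Y (harmonicComp ℓ g)).transpose.mulVec w) k = _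
    simp [Matrix.mulVec, dotProduct, LinearMap.toMatrix_apply]
  simp only [h]
  refine continuous_finsetSum _ fun j _ => Continuous.mul ?_ continuous_const
  -- The harmonics carry the topology of pointwise convergence; in finite dimension coordinates are
  -- continuous for it, so continuity in g need only be checked at each n.
  refine (LinearMap.continuous_of_finiteDimensional (Y.coord j)).comp ?_
  refine Continuous.subtype_mk (continuous_pi fun n => ?_) _
  exact (continuous_of_mem_sphericalHarmonics (Y k).2).comp
    (continuous_rotS.comp (by fun_prop : Continuous fun g : SO 3 => (g, n)))

end Continuity

/-! ### Coordinates on Hom(V ⊗ W, U) and conjugation -/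

section HomCoordinates

variable {𝕜 : Type*} [RCLike 𝕜] {κ : Type*} [Fintype κ] [DecidableEq κ]
  {V U : Type*} [NormedAddCommGroup V] [NormedSpace 𝕜 V] [FiniteDimensional 𝕜 V]
  [NormedAddCommGroup U] [NormedSpace 𝕜 U]

theorem contract_apply {W : Type*} [AddCommGroup W] [Module 𝕜 W] (F : V ⊗[𝕜] W →ₗ[𝕜] U) (y : W)
    (v : V) : contract F y v = F (v ⊗ₜ y) := rfl

/-- `Hom(V ⊗ 𝕜^κ, U)` consists of the families of maps `V → U` indexed by `κ`. -/
def homCoord (κ : Type*) [Fintype κ] [DecidableEq κ] :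
    (V ⊗[𝕜] (κ → 𝕜) →ₗ[𝕜] U) ≃ₗ[𝕜] (κ → V →L[𝕜] U) where
  toFun F k := contract F (Pi.single k 1)
  map_add' _ _ := rfl
  map_smul' _ _ := rfl
  invFun m := TensorProduct.lift (LinearMap.mk₂ 𝕜 (fun v w => ∑ k, w k • m k v)
    (fun v v' w => by simp [Finset.sum_add_distrib])
    (fun c v w => by simp [Finset.smul_sum, smul_comm c])
    (fun v w w' => by simp [Finset.sum_add_distrib, add_smul])
    (fun c v w => by simp [Finset.smul_sum, smul_smul]))
  left_inv F := by
    refine TensorProduct.ext' fun v w => ?_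
    simp only [TensorProduct.lift.tmul, LinearMap.mk₂_apply, contract_apply]
    conv_rhs => rw [pi_eq_sum_univ' w, TensorProduct.tmul_sum, map_sum]
    exact Finset.sum_congr rfl fun k _ => by
      rw [TensorProduct.tmul_smul, map_smul]
  right_inv m := by
    ext k v
    simp [contract_apply, Pi.single_apply]

theorem homCoord_symm_tmul (m : κ → V →L[𝕜] U) (v : V) (w : κ → 𝕜) :
    (homCoord κ).symm m (v ⊗ₜ w) = ∑ k, w k • m k v := rfl

theorem contract_homCoord_symm (m : κ → V →L[𝕜] U) (y : κ → 𝕜) :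
    contract ((homCoord κ).symm m) y = ∑ k, y k • m k := by
  ext v
  simp [contract_apply, homCoord_symm_tmul]

variable {G : Type*} [Group G]

/-- The conjugation representation on `Hom(V ⊗ 𝕜^κ, U)`, in coordinates. -/
def homCoordRep (σ : Representation 𝕜 G (V ⊗[𝕜] (κ → 𝕜))) (τ : Representation 𝕜 G U) :
    Representation 𝕜 G (κ → V →L[𝕜] U) where
  toFun h := (homCoord κ).toLinearMap ∘ₗ Representation.linHom σ τ h ∘ₗ
    (homCoord κ).symm.toLinearMap
  map_one' := by
    refine LinearMap.ext fun m => ?_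
    simp
  map_mul' g h := by
    refine LinearMap.ext fun m => ?_
    simp

theorem homCoord_symm_homCoordRep (σ : Representation 𝕜 G (V ⊗[𝕜] (κ → 𝕜)))
    (τ : Representation 𝕜 G U) (h : G) (m : κ → V →L[𝕜] U) :
    (homCoord κ).symm (homCoordRep σ τ h m) = τ h ∘ₗ (homCoord κ).symm m ∘ₗ σ h⁻¹ :=
  (homCoord κ).symm_apply_apply _

theorem continuous_homCoordRep [FiniteDimensional 𝕜 U] {ρ : Representation 𝕜 (SO 2) V}
    (hρ : ∀ v, Continuous fun h => ρ h v) {δ : Representation 𝕜 (SO 2) (κ → 𝕜)}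
    (hδ : ∀ w, Continuous fun h => δ h w) {τ : Representation 𝕜 (SO 2) U}
    (hτ : ∀ u, Continuous fun h => τ h u) (m : κ → V →L[𝕜] U) :
    Continuous fun h => homCoordRep (Representation.tprod ρ δ) τ h m := by
  refine continuous_pi fun k => continuous_clm_apply.2 fun v => ?_
  have h : ∀ h : SO 2, homCoordRep (Representation.tprod ρ δ) τ h m k v
      = τ h (∑ j, δ h⁻¹ (Pi.single k 1) j • m j (ρ h⁻¹ v)) := by
    intro h
    rw [← homCoord_symm_tmul]
    rfl
  simp only [h]
  refine (continuous_rep_apply τ hτ).comp (continuous_id.prodMk ?_)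
  refine continuous_finsetSum _ fun j _ => Continuous.smul ?_ ?_
  · exact (continuous_apply j).comp ((hδ _).comp (continuous_inv_SO 2))
  · exact (m j).continuous.comp ((hρ v).comp (continuous_inv_SO 2))

/-- The map `x ↦ τ(h)⁻¹ x ρ(h)` on `Hom(V, U)`. -/
def homConj [FiniteDimensional 𝕜 U] (ρ : Representation 𝕜 G V) (τ : Representation 𝕜 G U) (h : G) :
    (V →L[𝕜] U) →L[𝕜] (V →L[𝕜] U) :=
  ContinuousLinearMap.compL 𝕜 V U U (LinearMap.toContinuousLinearMap (τ h⁻¹)) ∘L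
    (ContinuousLinearMap.compL 𝕜 V V U).flip (LinearMap.toContinuousLinearMap (ρ h))

theorem homConj_apply [FiniteDimensional 𝕜 U] (ρ : Representation 𝕜 G V)
    (τ : Representation 𝕜 G U) (h : G) (x : V →L[𝕜] U) (v : V) :
    homConj ρ τ h x v = τ h⁻¹ (x (ρ h v)) := rfl

omit [Fintype κ] [DecidableEq κ] in
-- Moves the rotation of the harmonic vector into the coefficient, where it joins ρ to form the
-- tensor product representation.
theorem homConj_contract [FiniteDimensional 𝕜 U] (ρ : Representation 𝕜 G V)
    (δ : Representation 𝕜 G (κ → 𝕜)) (τ : Representation 𝕜 G U) (h : G)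
    (F : V ⊗[𝕜] (κ → 𝕜) →ₗ[𝕜] U) (y : κ → 𝕜) :
    homConj ρ τ h (contract F (δ h y))
      = contract (τ h⁻¹ ∘ₗ F ∘ₗ Representation.tprod ρ δ h) y := by
  ext v
  simp [homConj_apply, contract_apply]

end HomCoordinates

/-! ### A countable family of test sets -/

section TestSets

variable {α X : Type*} [NormedAddCommGroup X] [NormedSpace ℝ X] [CompleteSpace X]

theorem ae_eq_zero_of_setIntegral_eq_zero_of_isPiSystem {m : MeasurableSpace α} {μ : Measure α}
    {𝒜 : Set (Set α)} (hgen : m = MeasurableSpace.generateFrom 𝒜) (hpi : IsPiSystem 𝒜)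
    (huniv : Set.univ ∈ 𝒜) {f : α → X} (hf : Integrable f μ)
    (h : ∀ s ∈ 𝒜, ∫ x in s, f x ∂μ = 0) : f =ᵐ[μ] 0 := by
  have key : ∀ s, MeasurableSet s → ∫ x in s, f x ∂μ = 0 := by
    intro s hs
    induction s, hs using MeasurableSpace.induction_on_inter hgen hpi with
    | empty => simp
    | basic t ht => exact h t ht
    | compl t htm ih =>
      have h0 := h _ huniv
      rw [setIntegral_univ] at h0
      rw [← zero_add (∫ x in tᶜ, f x ∂μ), ← ih, integral_add_compl htm hf, h0]
      exact ih.symm ▸ rfl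
    | iUnion g hd hm ih =>
      rw [integral_iUnion hm hd hf.integrableOn]
      simp [ih]
  exact hf.ae_eq_zero_of_forall_setIntegral_eq_zero fun s hs _ => key s hs

/-- A countable family of bounded measurable sets of the plane whose integrals determine locally
integrable functions. -/
theorem exists_countable_test_sets :
    ∃ B : ℕ → Set (E 2), (∀ i, MeasurableSet (B i)) ∧ (∀ i, Bornology.IsBounded (B i)) ∧
      ∀ f : E 2 → X, (∀ R, IntegrableOn f (Metric.ball 0 R)) → (∀ i, ∫ x in B i, f x = 0) →
        f =ᵐ[volume] 0 := by
  set 𝒜 := generateSetAlgebra (MeasurableSpace.countableGeneratingSet (E 2)) with h𝒜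
  have halg : IsSetAlgebra 𝒜 := isSetAlgebra_generateSetAlgebra
  have hcount : 𝒜.Countable :=
    countable_generateSetAlgebra MeasurableSpace.countable_countableGeneratingSet
  have hgen : MeasurableSpace.generateFrom 𝒜 = borel (E 2) := by
    rw [h𝒜, ← BorelSpace.measurable_eq, generateFrom_generateSetAlgebra_eq, MeasurableSpace.generateFrom_countableGeneratingSet]
  obtain ⟨e, he⟩ := hcount.exists_eq_range ⟨_, halg.univ_mem⟩
  rw [← BorelSpace.measurable_eq] at hgen
  have hmeas : ∀ n, MeasurableSet (e n) := fun n =>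
    hgen ▸ MeasurableSpace.measurableSet_generateFrom (he ▸ ⟨n, rfl⟩)
  -- The index codes a pair: a member of a countable algebra generating the Borel sets, and an
  -- integer radius that makes it bounded.
  refine ⟨fun i => e i.unpair.1 ∩ Metric.ball 0 i.unpair.2,
    fun i => (hmeas _).inter Metric.isOpen_ball.measurableSet,
    fun i => Metric.isBounded_ball.subset Set.inter_subset_right, fun f hf h => ?_⟩
  have hN : ∀ N : ℕ, f =ᵐ[volume.restrict (Metric.ball 0 N)] 0 := by
    intro N
    refine ae_eq_zero_of_setIntegral_eq_zero_of_isPiSystem hgen.symm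
      (fun s hs t ht _ => halg.inter_mem hs ht) halg.univ_mem (hf N) fun s hs => ?_
    obtain ⟨n, rfl⟩ := he ▸ hs
    rw [Measure.restrict_restrict (hmeas n)]
    simpa using h (Nat.pair n N)
  have hall : ∀ᵐ x, ∀ N : ℕ, x ∈ Metric.ball (0 : E 2) N → f x = 0 :=
    ae_all_iff.2 fun N => (ae_restrict_iff' Metric.isOpen_ball.measurableSet).1 (hN N)
  filter_upwards [hall] with x hx
  obtain ⟨N, hN⟩ := exists_nat_gt ‖x‖
  exact hx N (by simpa using hN)

end TestSets

/-! ### Equivariance of the operator as invariance of its kernel -/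

section Operators

variable {𝕜 : Type*} [RCLike 𝕜]
  {V U : Type*} [NormedAddCommGroup V] [NormedSpace 𝕜 V] [FiniteDimensional 𝕜 V]
  [NormedAddCommGroup U] [NormedSpace 𝕜 U]

omit [FiniteDimensional 𝕜 V] in
theorem indicator_mem_planarFields (v : V) {B : Set (E 2)} (hB : MeasurableSet B)
    (hb : Bornology.IsBounded B) : B.indicator (fun _ => v) ∈ planarFields 𝕜 V := by
  refine ⟨memLp_top_of_bound (aestronglyMeasurable_const.indicator hB) ‖v‖
    (ae_of_all _ fun x => norm_indicator_le_norm_self _ _), ?_⟩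
  exact HasCompactSupport.of_support_subset_isCompact hb.isCompact_closure
    (Set.support_indicator_subset.trans subset_closure)

variable [NormedSpace ℝ U] [FiniteDimensional 𝕜 U]

/-- The kernel `κ`, moved by the rotation `h` in both variables and conjugated. -/
def twistedKernel (ρ : Representation 𝕜 (SO 2) V) (τ : Representation 𝕜 (SO 2) U) (h : SO 2)
    (κ : S2 → E 2 → V →L[𝕜] U) (n : S2) (r : E 2) : V →L[𝕜] U :=
  homConj ρ τ h (κ (rotS (inPlane h) n) (rot h r))

theorem ae_rotS_iff (g : SO 3) {p : S2 → Prop} :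
    (∀ᵐ n ∂sphereMeasure, p (rotS g n)) ↔ ∀ᵐ n ∂sphereMeasure, p n := by
  refine ⟨fun h => ?_, fun h => (measurePreserving_rotS g).quasiMeasurePreserving.ae h⟩
  have := (measurePreserving_rotS g⁻¹).quasiMeasurePreserving.ae h
  simpa only [rotS_rotS_inv] using this

/-- Evaluate both fields at hn, substitute hr for r in the integral, and cancel ρ↑(h). -/
theorem equivariant_apply_iff (ρ : Representation 𝕜 (SO 2) V) (ρup : Representation 𝕜 (SO 3) U)
    {κ : S2 → E 2 → V →L[𝕜] U} {Φ : planarFields 𝕜 V →ₗ[𝕜] (S2 → U)}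
    (hΦ : ∀ f, Φ f =ᵐ[sphereMeasure] fun n => ∫ r, κ n r (f.1 r)) (h : SO 2)
    (f : planarFields 𝕜 V) :
    Φ (planarRep ρ h f) =ᵐ[sphereMeasure] sphereRep ρup (inPlane h) (Φ f) ↔
      ∀ᵐ n ∂sphereMeasure, ∫ r, twistedKernel ρ (ρup.comp inPlane) h κ n r (f.1 r)
        = ∫ r, κ n r (f.1 r) := by
  have h1 : ∀ n, ∫ r, twistedKernel ρ (ρup.comp inPlane) h κ n r (f.1 r)
      = (ρup.comp inPlane) h⁻¹
        (∫ r, κ (rotS (inPlane h) n) r ((planarRep ρ h f).1 r)) := by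
    intro n
    rw [← rep_integral_comm]
    refine Eq.trans ?_ ((rot h).measurePreserving.integral_comp
      (rot h).toHomeomorph.measurableEmbedding _)
    refine integral_congr_ae (ae_of_all _ fun r => ?_)
    change _ = (ρup.comp inPlane) h⁻¹
      (κ (rotS (inPlane h) n) (rot h r) (ρ h (f.1 (rot h⁻¹ (rot h r)))))
    rw [rot_inv_rot]
    rfl
  rw [EventuallyEq, ← ae_rotS_iff (inPlane h)]
  have h2 := (ae_rotS_iff (inPlane h)).2 (hΦ (planarRep ρ h f))
  refine eventually_congr ?_
  filter_upwards [h2, hΦ f] with n hn hn'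
  rw [h1, ← hn, ← hn']
  change _ = ρup (inPlane h) (Φ f (rotS (inPlane h)⁻¹ (rotS (inPlane h) n))) ↔ _
  rw [rotS_inv_rotS]
  change _ = (ρup.comp inPlane) h (Φ f n) ↔ _
  constructor
  · intro e
    rw [e, rep_inv_apply_self]
  · intro e
    rw [← e, rep_self_inv_apply]

omit [NormedSpace ℝ U] in
theorem aestronglyMeasurable_twistedKernel (ρ : Representation 𝕜 (SO 2) V)
    (τ : Representation 𝕜 (SO 2) U) {κ : S2 → E 2 → V →L[𝕜] U} (hκ : IsImageToSphereKernel κ)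
    (h : SO 2) :
    AEStronglyMeasurable (Function.uncurry (twistedKernel ρ τ h κ))
      (sphereMeasure.prod volume) := by
  refine (homConj ρ τ h).continuous.comp_aestronglyMeasurable ?_
  exact hκ.aestronglyMeasurable.comp_measurePreserving
    ((measurePreserving_rotS (inPlane h)).prod (rot h).measurePreserving)

omit [FiniteDimensional 𝕜 V] [NormedSpace ℝ U] [FiniteDimensional 𝕜 U] in
theorem integrableOn_ball_apply {K : E 2 → V →L[𝕜] U} (hK : LocallyIntegrable K volume) (v : V)
    (R : ℝ) : IntegrableOn (fun r => K r v) (Metric.ball 0 R) :=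
  (ContinuousLinearMap.apply 𝕜 U v).integrable_comp
    ((hK.integrableOn_isCompact (isCompact_closedBall 0 R)).mono_set Metric.ball_subset_closedBall)

omit [NormedSpace ℝ U] in
theorem integrableOn_ball_twistedKernel (ρ : Representation 𝕜 (SO 2) V)
    (τ : Representation 𝕜 (SO 2) U) {κ : S2 → E 2 → V →L[𝕜] U} {h : SO 2} {n : S2}
    (hn : LocallyIntegrable (κ (rotS (inPlane h) n)) volume) (v : V) (R : ℝ) :
    IntegrableOn (fun r => twistedKernel ρ τ h κ n r v) (Metric.ball 0 R) := by
  have h1 := integrableOn_ball_apply hn (ρ h v) R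
  have h2 := ((rot h).measurePreserving.integrableOn_comp_preimage
    (rot h).toHomeomorph.measurableEmbedding).2 h1
  rw [(rot h).preimage_ball, map_zero] at h2
  exact (LinearMap.toContinuousLinearMap (τ h⁻¹)).integrable_comp h2

/-- An integral operator is equivariant if and only if its kernel is invariant. -/
theorem equivariant_iff_twistedKernel (ρ : Representation 𝕜 (SO 2) V)
    (ρup : Representation 𝕜 (SO 3) U) {κ : S2 → E 2 → V →L[𝕜] U} (hκ : IsImageToSphereKernel κ)
    {Φ : planarFields 𝕜 V →ₗ[𝕜] (S2 → U)}
    (hΦ : ∀ f, Φ f =ᵐ[sphereMeasure] fun n => ∫ r, κ n r (f.1 r)) (h : SO 2) :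
    (∀ f : planarFields 𝕜 V,
        Φ (planarRep ρ h f) =ᵐ[sphereMeasure] sphereRep ρup (inPlane h) (Φ f)) ↔
      ∀ᵐ r, ∀ᵐ n ∂sphereMeasure, twistedKernel ρ (ρup.comp inPlane) h κ n r = κ n r := by
  have : CompleteSpace U := FiniteDimensional.complete 𝕜 U
  simp only [equivariant_apply_iff ρ ρup hΦ]
  have hcomm := ae_ae_eq_comm (aestronglyMeasurable_twistedKernel ρ (ρup.comp inPlane) hκ h)
    hκ.aestronglyMeasurable
  simp only [Function.uncurry_apply_pair] at hcomm
  -- The integrals live at fixed n, so the comparison of kernels is made for almost every n, then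
  -- almost every r.
  rw [← hcomm]
  constructor
  · intro hf
    obtain ⟨B, hBm, hBb, hB⟩ := exists_countable_test_sets (X := U)
    set b := Module.finBasis 𝕜 V with hb
    -- Each test field has its own null set of n; countably many sets and finitely many basis
    -- vectors leave one common null set.
    have h1 : ∀ᵐ n ∂sphereMeasure, ∀ i j,
        ∫ r, twistedKernel ρ (ρup.comp inPlane) h κ n r ((B i).indicator (fun _ => b j) r)
          = ∫ r, κ n r ((B i).indicator (fun _ => b j) r) :=
      ae_all_iff.2 fun i => ae_all_iff.2 fun j =>
        hf ⟨_, indicator_mem_planarFields (b j) (hBm i) (hBb i)⟩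
    filter_upwards [h1, hκ.locallyIntegrable,
      (ae_rotS_iff (inPlane h)).2 hκ.locallyIntegrable] with n hn hloc hloc'
    have h2 : ∀ᵐ r, ∀ j, twistedKernel ρ (ρup.comp inPlane) h κ n r (b j) = κ n r (b j) := by
      refine ae_all_iff.2 fun j => ?_
      have hi1 := integrableOn_ball_twistedKernel ρ (ρup.comp inPlane) hloc' (b j)
      have hi2 := integrableOn_ball_apply hloc (b j)
      have h0 := hB _ (fun R => (hi1 R).sub (hi2 R)) fun i => ?_
      · filter_upwards [h0] with r hr
        exact sub_eq_zero.1 hr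
      · obtain ⟨R, hR⟩ := (hBb i).subset_ball 0
        have h3 := hn i j
        have hind : ∀ K : E 2 → V →L[𝕜] U, (∫ r, K r ((B i).indicator (fun _ => b j) r))
            = ∫ r in B i, K r (b j) := by
          intro K
          rw [← integral_indicator (hBm i)]
          congr 1
          ext r
          by_cases hr : r ∈ B i <;> simp [hr]
        rw [hind, hind] at h3
        change ∫ r in B i, (twistedKernel ρ (ρup.comp inPlane) h κ n r (b j) - κ n r (b j)) = 0
        rw [integral_sub ((hi1 R).mono_set hR) ((hi2 R).mono_set hR), h3, sub_self]
    filter_upwards [h2] with r hr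
    exact ContinuousLinearMap.coe_injective (b.ext hr)
  · intro hae f
    filter_upwards [hae] with n hn
    refine integral_congr_ae ?_
    filter_upwards [hn] with r hr
    exact congrArg (fun K : V →L[𝕜] U => K (f.1 r)) hr

end Operators

/-! ### Harmonic expansions: uniqueness and behaviour under rotation -/

section Expansion

variable {𝕜 : Type*} [RCLike 𝕜]
  {V U : Type*} [NormedAddCommGroup V] [NormedSpace 𝕜 V] [FiniteDimensional 𝕜 V]
  [NormedAddCommGroup U] [NormedSpace 𝕜 U]
  {ι : ℕ → Type*} [∀ ℓ, Fintype (ι ℓ)]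

/-- The function `g` on the sphere is the sum in `L²` of the contractions of the coefficients `F ℓ`
with the spherical harmonics. -/
def HasHarmonicExpansion (Y : ∀ ℓ, Module.Basis (ι ℓ) 𝕜 (sphericalHarmonics 𝕜 ℓ))
    (g : S2 → V →L[𝕜] U) (F : ∀ ℓ, V ⊗[𝕜] (ι ℓ → 𝕜) →ₗ[𝕜] U) : Prop :=
  Tendsto (fun L : ℕ => eLpNorm
    (fun n => g n - ∑ ℓ ∈ Finset.range L, contract (F ℓ) (harmonicVector (Y ℓ) n))
    2 sphereMeasure) atTop (𝓝 0)

theorem continuous_contract_harmonicVector [∀ ℓ, DecidableEq (ι ℓ)]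
    (Y : ∀ ℓ, Module.Basis (ι ℓ) 𝕜 (sphericalHarmonics 𝕜 ℓ))
    (F : ∀ ℓ, V ⊗[𝕜] (ι ℓ → 𝕜) →ₗ[𝕜] U) (L : ℕ) :
    Continuous fun n => ∑ ℓ ∈ Finset.range L, contract (F ℓ) (harmonicVector (Y ℓ) n) := by
  refine continuous_finsetSum _ fun ℓ _ => ?_
  have h : ∀ y, contract (F ℓ) y = ∑ k, y k • homCoord (ι ℓ) (F ℓ) k := fun y => by
    rw [← contract_homCoord_symm, LinearEquiv.symm_apply_apply]
  simp only [h]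
  exact continuous_finsetSum _ fun k _ =>
    (continuous_of_mem_sphericalHarmonics (Y ℓ k).2).smul continuous_const

variable [∀ ℓ, DecidableEq (ι ℓ)] {Y : ∀ ℓ, Module.Basis (ι ℓ) 𝕜 (sphericalHarmonics 𝕜 ℓ)}
  {g g' : S2 → V →L[𝕜] U} {F F' : ∀ ℓ, V ⊗[𝕜] (ι ℓ → 𝕜) →ₗ[𝕜] U}

omit [∀ ℓ, Fintype (ι ℓ)] [∀ ℓ, DecidableEq (ι ℓ)] in
theorem HasHarmonicExpansion.congr_ae (h : HasHarmonicExpansion Y g F)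
    (hg : g =ᵐ[sphereMeasure] g') : HasHarmonicExpansion Y g' F := by
  refine Tendsto.congr (fun L => eLpNorm_congr_ae ?_) h
  filter_upwards [hg] with n hn
  rw [hn]

theorem tendsto_eLpNorm_sub {α X : Type*} [MeasurableSpace α] [NormedAddCommGroup X]
    {μ : Measure α} {u v : ℕ → α → X} (hu : ∀ L, AEStronglyMeasurable (u L) μ)
    (hv : ∀ L, AEStronglyMeasurable (v L) μ)
    (hu0 : Tendsto (fun L => eLpNorm (u L) 2 μ) atTop (𝓝 0))
    (hv0 : Tendsto (fun L => eLpNorm (v L) 2 μ) atTop (𝓝 0)) :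
    Tendsto (fun L => eLpNorm (u L - v L) 2 μ) atTop (𝓝 0) := by
  have h := hu0.add hv0
  rw [add_zero] at h
  exact tendsto_of_tendsto_of_tendsto_of_le_of_le tendsto_const_nhds h (fun _ => zero_le)
    fun L => eLpNorm_sub_le (hu L) (hv L) (by norm_num)

theorem aestronglyMeasurable_remainder (hg : AEStronglyMeasurable g sphereMeasure) (L : ℕ) :
    AEStronglyMeasurable (fun n => g n -
      ∑ ℓ ∈ Finset.range L, contract (F ℓ) (harmonicVector (Y ℓ) n)) sphereMeasure :=
  hg.sub (continuous_contract_harmonicVector Y F L).aestronglyMeasurable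

/-- The difference of the two remainders is g - g' for every L, while its norm tends to zero. -/
theorem HasHarmonicExpansion.ae_eq (h : HasHarmonicExpansion Y g F)
    (h' : HasHarmonicExpansion Y g' F) (hg : AEStronglyMeasurable g sphereMeasure)
    (hg' : AEStronglyMeasurable g' sphereMeasure) : g =ᵐ[sphereMeasure] g' := by
  have h0 := tendsto_eLpNorm_sub (aestronglyMeasurable_remainder hg)
    (aestronglyMeasurable_remainder hg') h h'
  have h1 : ∀ L, (fun n => g n -
      ∑ ℓ ∈ Finset.range L, contract (F ℓ) (harmonicVector (Y ℓ) n)) - (fun n => g' n -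
      ∑ ℓ ∈ Finset.range L, contract (F ℓ) (harmonicVector (Y ℓ) n)) = g - g' := by
    intro L
    ext1 n
    simp
  simp only [h1] at h0
  have h2 := tendsto_nhds_unique h0 tendsto_const_nhds
  rw [eq_comm, eLpNorm_eq_zero_iff (hg.sub hg') (by norm_num)] at h2
  exact sub_ae_eq_zero _ _ |>.1 h2

theorem HasHarmonicExpansion.unique [FiniteDimensional 𝕜 U] (h : HasHarmonicExpansion Y g F)
    (h' : HasHarmonicExpansion Y g F') (hg : AEStronglyMeasurable g sphereMeasure) (ℓ : ℕ) :
    F ℓ = F' ℓ := by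
  have h0 := tendsto_eLpNorm_sub (aestronglyMeasurable_remainder hg)
    (aestronglyMeasurable_remainder hg) h' h
  have h1 : ∀ L, (fun n => g n -
      ∑ ℓ ∈ Finset.range L, contract (F' ℓ) (harmonicVector (Y ℓ) n)) - (fun n => g n -
      ∑ ℓ ∈ Finset.range L, contract (F ℓ) (harmonicVector (Y ℓ) n))
        = fun n => ∑ ℓ ∈ Finset.range L, ∑ k, (Y ℓ k).1 n • homCoord (ι ℓ) (F ℓ - F' ℓ) k := by
    intro L
    ext1 n
    rw [Pi.sub_apply, sub_sub_sub_cancel_left, ← Finset.sum_sub_distrib]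
    refine Finset.sum_congr rfl fun ℓ _ => ?_
    refine Eq.trans ?_ (contract_homCoord_symm (homCoord (ι ℓ) (F ℓ - F' ℓ))
      (harmonicVector (Y ℓ) n))
    rw [LinearEquiv.symm_apply_apply]
    rfl
  simp only [h1] at h0
  have h2 : homCoord (ι ℓ) (F ℓ - F' ℓ) = 0 :=
    funext fun k => coeff_eq_zero_of_tendsto Y (a := fun ℓ => homCoord (ι ℓ) (F ℓ - F' ℓ)) h0 ℓ k
  exact sub_eq_zero.1 ((homCoord (ι ℓ)).map_eq_zero_iff.1 h2)

/-- Rotating the sphere preserves the L² norm of the remainder, and conjugation enlarges it by at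
most a constant factor. -/
theorem HasHarmonicExpansion.conj [FiniteDimensional 𝕜 U] (h : HasHarmonicExpansion Y g F)
    (hg : AEStronglyMeasurable g sphereMeasure) (ρ : Representation 𝕜 (SO 2) V)
    (τ : Representation 𝕜 (SO 2) U) (s : SO 2) :
    HasHarmonicExpansion Y (fun n => homConj ρ τ s (g (rotS (inPlane s) n)))
      (fun ℓ => τ s⁻¹ ∘ₗ F ℓ ∘ₗ Representation.tprod ρ ((wignerD (Y ℓ)).comp inPlane) s) := by
  have h0 : Tendsto (fun L : ℕ => eLpNorm ((fun n => g n -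
      ∑ ℓ ∈ Finset.range L, contract (F ℓ) (harmonicVector (Y ℓ) n)) ∘ rotS (inPlane s))
      2 sphereMeasure) atTop (𝓝 0) :=
    h.congr fun L => (eLpNorm_comp_measurePreserving (aestronglyMeasurable_remainder hg L)
      (measurePreserving_rotS (inPlane s))).symm
  refine tendsto_eLpNorm_zero_of_le ‖homConj ρ τ s‖ (fun L n => ?_) h0
  refine le_of_eq_of_le (congrArg norm ?_) ((homConj ρ τ s).le_opNorm _)
  simp only [Function.comp_apply, map_sub, map_sum]
  congr 1
  refine Finset.sum_congr rfl fun ℓ _ => ?_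
  rw [← homConj_contract, harmonicVector_rotS]
  rfl

theorem aestronglyMeasurable_pi {α κ X : Type*} [Fintype κ] [MeasurableSpace α]
    [NormedAddCommGroup X] {μ : Measure α} {f : α → κ → X}
    (hf : ∀ k, AEStronglyMeasurable (fun a => f a k) μ) : AEStronglyMeasurable f μ := by
  classical
  have h : f = fun a => ∑ k, Pi.single k (f a k) := funext fun a => (Finset.univ_sum_single _).symm
  rw [h]
  exact Finset.aestronglyMeasurable_fun_sum _ fun k _ =>
    (continuous_single k).comp_aestronglyMeasurable (hf k)

end Expansion

/-! ### Measurable dependence of the coefficients on the plane -/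

section Coefficients

variable {𝕜 : Type*} [RCLike 𝕜]
  {V U : Type*} [NormedAddCommGroup V] [NormedSpace 𝕜 V] [FiniteDimensional 𝕜 V]
  [NormedAddCommGroup U] [NormedSpace 𝕜 U]
  [NormedSpace ℝ U] [IsScalarTower ℝ 𝕜 U] [FiniteDimensional 𝕜 U]
  {ι : ℕ → Type*} [∀ ℓ, Fintype (ι ℓ)] [∀ ℓ, DecidableEq (ι ℓ)]

/-- An image-to-sphere kernel has expansions into spherical harmonics whose coefficients depend
measurably on the point of the plane. -/
theorem exists_measurable_coefficients (Y : ∀ ℓ, Module.Basis (ι ℓ) 𝕜 (sphericalHarmonics 𝕜 ℓ))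
    {κ : S2 → E 2 → V →L[𝕜] U} (hκ : IsImageToSphereKernel κ) :
    ∃ c : ∀ ℓ, E 2 → ι ℓ → V →L[𝕜] U, (∀ ℓ, AEStronglyMeasurable (c ℓ) volume) ∧
      ∀ᵐ r, HasHarmonicExpansion Y (fun n => κ n r) fun ℓ => (homCoord (ι ℓ)).symm (c ℓ r) := by
  obtain ⟨Z, hZ, hexp⟩ := exists_vector_harmonic_expansion Y (V →L[𝕜] U)
  refine ⟨fun ℓ r k => ∫ m, Z ℓ k m • κ m r ∂sphereMeasure, fun ℓ => ?_, ?_⟩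
  · refine aestronglyMeasurable_pi fun k => ?_
    refine AEStronglyMeasurable.integral_prod_right'
      (f := fun z : E 2 × S2 => Z ℓ k z.2 • κ z.2 z.1) ?_
    exact ((hZ ℓ k).comp continuous_snd).aestronglyMeasurable.smul hκ.aestronglyMeasurable.prod_swap
  · filter_upwards [hκ.memLp] with r hr
    unfold HasHarmonicExpansion
    simp only [contract_homCoord_symm]
    exact hexp _ hr

end Coefficients

end

/-! ### Equivariance and steerable coefficients -/

theorem theorem1 {𝕜 : Type*} [RCLike 𝕜]
    {V U : Type*} [NormedAddCommGroup V] [NormedSpace 𝕜 V] [FiniteDimensional 𝕜 V]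
    [NormedAddCommGroup U] [NormedSpace 𝕜 U]
    [NormedSpace ℝ U] [IsScalarTower ℝ 𝕜 U] [FiniteDimensional 𝕜 U]
    (ρ : Representation 𝕜 (SO 2) V) (hρ : ∀ v, Continuous fun h => ρ h v)
    (ρup : Representation 𝕜 (SO 3) U) (hρup : ∀ u, Continuous fun g => ρup g u)
    {ι : ℕ → Type*} [∀ ℓ, Fintype (ι ℓ)] [∀ ℓ, DecidableEq (ι ℓ)]
    (Y : ∀ ℓ, Module.Basis (ι ℓ) 𝕜 (sphericalHarmonics 𝕜 ℓ))
    (κ : S2 → E 2 → V →L[𝕜] U) (hκ : IsImageToSphereKernel κ)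
    (Φ : planarFields 𝕜 V →ₗ[𝕜] (S2 → U))
    (hΦ : ∀ f, Φ f =ᵐ[sphereMeasure] fun n => ∫ r, κ n r (f.1 r)) :
    (∀ (h : SO 2) (f : planarFields 𝕜 V),
        Φ (planarRep ρ h f) =ᵐ[sphereMeasure] sphereRep ρup (inPlane h) (Φ f)) ↔
      ∃ F : ∀ ℓ, E 2 → V ⊗[𝕜] (ι ℓ → 𝕜) →ₗ[𝕜] U,
        (∀ ℓ, IsSteerableKernel (Representation.tprod ρ ((wignerD (Y ℓ)).comp inPlane))
          (ρup.comp inPlane) (F ℓ)) ∧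
        ∀ᵐ r ∂(volume : Measure (E 2)),
          Tendsto (fun L : ℕ => eLpNorm
            (fun n => κ n r - ∑ ℓ ∈ Finset.range L, contract (F ℓ r) (harmonicVector (Y ℓ) n))
            2 sphereMeasure) atTop (𝓝 0) := by
  set τ : Representation 𝕜 (SO 2) U := ρup.comp inPlane with hτ
  set σ : ∀ ℓ, Representation 𝕜 (SO 2) (V ⊗[𝕜] (ι ℓ → 𝕜)) :=
    fun ℓ => Representation.tprod ρ ((wignerD (Y ℓ)).comp inPlane) with hσ
  have hinv : ∀ (s : SO 2) {p : E 2 → Prop}, (∀ᵐ r, p r) → ∀ᵐ r, p (rot s r) := fun s _ hp =>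
    (rot s).measurePreserving.quasiMeasurePreserving.ae hp
  have hcancel : ∀ ℓ (s : SO 2) (F₁ F₂ : V ⊗[𝕜] (ι ℓ → 𝕜) →ₗ[𝕜] U),
      τ s⁻¹ ∘ₗ F₁ ∘ₗ σ ℓ s = F₂ ↔ F₁ = τ s ∘ₗ F₂ ∘ₗ σ ℓ s⁻¹ := by
    intro ℓ s F₁ F₂
    constructor
    · rintro rfl
      refine LinearMap.ext fun x => ?_
      simp only [LinearMap.comp_apply, rep_self_inv_apply]
    · rintro rfl
      refine LinearMap.ext fun x => ?_
      simp only [LinearMap.comp_apply, rep_inv_apply_self]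
  refine (forall_congr' fun h => equivariant_iff_twistedKernel ρ ρup hκ hΦ h).trans ?_
  constructor
  · intro hKE
    obtain ⟨c, hc, hexp⟩ := exists_measurable_coefficients Y hκ
    have hcinv : ∀ ℓ s, ∀ᵐ r, c ℓ (rot s r) = homCoordRep (σ ℓ) τ s (c ℓ r) := by
      intro ℓ s
      filter_upwards [hKE s, hexp, hinv s hexp, hκ.memLp, hinv s hκ.memLp]
        with r hr h1 h2 hm1 hm2
      -- The expansion at the rotated point, twisted back, is by invariance a second expansion of
      -- κ(·, r); uniqueness compares it with the first.
      have h3 := (h2.conj hm2.1 ρ τ s).congr_ae hr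
      have h4 := h3.unique h1 hm1.1 ℓ
      apply (homCoord (ι ℓ)).symm.injective
      rw [homCoord_symm_homCoordRep]
      exact (hcancel ℓ s _ _).1 h4
    have hcont : ∀ ℓ m, Continuous fun h => homCoordRep (σ ℓ) τ h m := fun ℓ =>
      continuous_homCoordRep hρ (fun w => (continuous_wignerD (Y ℓ) w).comp continuous_inPlane)
        fun u => (hρup u).comp continuous_inPlane
    choose c' hc' hcc' using fun ℓ =>
      exists_equivariant_ae_eq (homCoordRep (σ ℓ) τ) (hcont ℓ) (hc ℓ) (hcinv ℓ)
    refine ⟨fun ℓ r => (homCoord (ι ℓ)).symm (c' ℓ r), fun ℓ h r => ?_, ?_⟩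
    · simp only [hc', homCoord_symm_homCoordRep]
      rfl
    · filter_upwards [hexp, ae_all_iff.2 hcc'] with r hr hr'
      simp only [hr']
      exact hr
  · rintro ⟨F, hF, hexp⟩ s
    filter_upwards [hexp, hinv s hexp, hκ.memLp, hinv s hκ.memLp] with r h1 h2 hm1 hm2
    have h1' : HasHarmonicExpansion Y (fun n => κ n r) fun ℓ => F ℓ r := h1
    have h2' : HasHarmonicExpansion Y (fun n => κ n (rot s r)) fun ℓ => F ℓ (rot s r) := h2
    have h3 := h2'.conj hm2.1 ρ τ s
    -- Steerability says that the twisted kernel and the kernel have the same coefficients at r, so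
    -- they agree for almost every n.
    rw [show (fun ℓ => τ s⁻¹ ∘ₗ F ℓ (rot s r) ∘ₗ σ ℓ s) = fun ℓ => F ℓ r from
      funext fun ℓ => (hcancel ℓ s _ _).2 (hF ℓ s r)] at h3
    refine h3.ae_eq h1' ?_ hm1.1
    exact (homConj ρ τ s).continuous.comp_aestronglyMeasurable
      (hm2.1.comp_measurePreserving (measurePreserving_rotS (inPlane s)))
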